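/- Let $d\ge 0$ and let $\mathcal P_0$ be the set of all distributions $P$ of $(X,Y,Z)\in\mathbb R\times\mathbb R\times\mathbb R^{d}$ that are absolutely continuous with respect to Lebesgue measure and satisfy $X\perp\!\!\!\perp Y\mid Z$. For a distribution $P$ under which the conditional expectations exist (as is the case if $E_P|X|,E_P|Y|<\infty$) put $f_P(z)=E_P(X\mid Z=z)$, $g_P(z)=E_P(Y\mid Z=z)$, $\varepsilon_P=X-f_P(Z)$, $\xi_P=Y-g_P(Z)$, $u_P(z)=E_P(\varepsilon_P^2\mid Z=z)$ and $v_P(z)=E_P(\xi_P^2\mid Z=z)$; all distributions considered below are of this kind. Let $(x_i,y_i,z_i)$, $i=1,\dots,n$, be i.i.d. copies of $(X,Y,Z)$, let $\hat f=\hat f^{(n)}$ be an estimate of $f_P$ obtained by regressing $(x_i)_{i\le n}$ on $(z_i)_{i\le n}$ (a measurable function of these data only), and let $\hat g=\hat g^{(n)}$ be an estimate of $g_P$ obtained in the same way from $(y_i)_{i\le n}$ and $(z_i)_{i\le n}$. Let $R_i=\{x_i-\hat f(z_i)\}\{y_i-\hat g(z_i)\}$ and \[ T^{(n)}=\frac{\sqrt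 n\cdot\frac1n\sum_{i=1}^nR_i}{\Big(\frac1n\sum_{i=1}^nR_i^2-\big(\frac1n\sum_{r=1}^nR_r\big)^2\Big)^{1/2}} . \] Define \[ A_f=\frac1n\sum_{i=1}^n\{f_P(z_i)-\hat f(z_i)\}^2,\qquad B_f=\frac1n\sum_{i=1}^n\{f_P(z_i)-\hat f(z_i)\}^2v_P(z_i), \] \[ A_g=\frac1n\sum_{i=1}^n\{g_P(z_i)-\hat g(z_i)\}^2,\qquad B_g=\frac1n\sum_{i=1}^n\{g_P(z_i)-\hat g(z_i)\}^2u_P(z_i). \] For a class $\mathcal P$ of distributions and random variables $V_{P,n}$, write $V_{P,n}=o_{\mathcal P}(1)$ if $\sup_{P\in\mathcal P}\mathbb P_P(|V_{P,n}|>\epsilon)\to0$ as $n\to\infty$ for every $\epsilon>0$, write $V_{P,n}=o_{\mathcal P}(n^{-1})$ if $nV_{P,n}=o_{\mathcal P}(1)$, and write $o_P$ for $o_{\{P\}}$. Let $\Phi$ be the standard normal distribution function. (i) If $P\in\mathcal P_0$, $A_fA_g=o_P(n^{-1})$, $B_f=o_P(1)$, $B_g=o_P(1)$ and $0<E_P(\varepsilon_P^2\xi_P^2)<\infty$,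 then \[ \sup_{t\in\mathbb R}\big|\mathbb P_P(T^{(n)}\le t)-\Phi(t)\big|\to0\qquad(n\to\infty). \] (ii) Let $\mathcal P\subset\mathcal P_0$ be a class of distributions such that $A_fA_g=o_{\mathcal P}(n^{-1})$, $B_f=o_{\mathcal P}(1)$ and $B_g=o_{\mathcal P}(1)$. If in addition $\inf_{P\in\mathcal P}E_P(\varepsilon_P^2\xi_P^2)\ge c_1$ and $\sup_{P\in\mathcal P}E_P\{|\varepsilon_P\xi_P|^{2+\eta}\}\le c_2$ for some $c_1,c_2>0$ and $\eta>0$, then \[ \sup_{P\in\mathcal P}\sup_{t\in\mathbb R}\big|\mathbb P_P(T^{(n)}\le t)-\Phi(t)\big|\to0\qquad(n\to\infty). \] -/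

import Mathlib

open MeasureTheory ProbabilityTheory Filter Topology
open scoped ENNReal

noncomputable section

namespace GCM

/-- One observation `(x, y, z)` of `(X, Y, Z)`, with `X`, `Y` real and `Z` in `ℝ^d`. -/
abbrev Obs (d : ℕ) : Type := ℝ × ℝ × (Fin d → ℝ)

/-- The coordinate `X`. -/
def coordX {d : ℕ} (o : Obs d) : ℝ := o.1

/-- The coordinate `Y`. -/
def coordY {d : ℕ} (o : Obs d) : ℝ := o.2.1

/-- The coordinate `Z`. -/
def coordZ {d : ℕ} (o : Obs d) : Fin d → ℝ := o.2.2

lemma measurable_coordZ {d : ℕ} : Measurable (coordZ (d := d)) :=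
  measurable_snd.comp measurable_snd

/-- The law of an i.i.d. sample of size `n` from `P`. -/
abbrev sampleLaw {d : ℕ} (P : ProbabilityMeasure (Obs d)) (n : ℕ) : Measure (Fin n → Obs d) :=
  Measure.pi fun _ => (P : Measure (Obs d))

/-- The null hypothesis: laws of `(X, Y, Z)` that are absolutely continuous with respect to
Lebesgue measure and under which `X` and `Y` are conditionally independent given `Z`. -/
def nullClass (d : ℕ) : Set (ProbabilityMeasure (Obs d)) :=
  {P | (P : Measure (Obs d)) ≪ volume ∧
    CondIndepFun (MeasurableSpace.comap (coordZ (d := d)) inferInstance)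
      measurable_coordZ.comap_le coordX coordY (P : Measure (Obs d))}

/-- The (regular) conditional law of the real coordinate `W` (`X` or `Y`) given `Z = z`. -/
def condLaw {d : ℕ} (W : Obs d → ℝ) (P : ProbabilityMeasure (Obs d)) (z : Fin d → ℝ) :
    Measure ℝ :=
  condDistrib W coordZ (P : Measure (Obs d)) z

/-- The conditional expectation `E_P(W | Z = z)` is meaningful: for almost every `z` the
conditional law of `W` given `Z = z` has a finite first moment. This holds in particular when
`E_P |W| < ∞`. -/
def HasCondMean {d : ℕ} (W : Obs d → ℝ) (P : ProbabilityMeasure (Obs d)) : Prop :=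
  ∀ᵐ z ∂((P : Measure (Obs d)).map coordZ), Integrable (fun w : ℝ => w) (condLaw W P z)

/-- The regression function `z ↦ E_P(W | Z = z)`: it is `f_P` for `W = X` and `g_P` for
`W = Y`. -/
def condMean {d : ℕ} (W : Obs d → ℝ) (P : ProbabilityMeasure (Obs d)) (z : Fin d → ℝ) : ℝ :=
  ∫ w, w ∂(condLaw W P z)

/-- The conditional variance `z ↦ E_P((W - E_P(W | Z))^2 | Z = z)`, a value in `[0, ∞]`: it is
`u_P` for `W = X` and `v_P` for `W = Y`. -/
def condVariance {d : ℕ} (W : Obs d → ℝ) (P : ProbabilityMeasure (Obs d)) (z : Fin d → ℝ) :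
    ℝ≥0∞ :=
  ∫⁻ w, ENNReal.ofReal ((w - condMean W P z) ^ 2) ∂(condLaw W P z)

/-- The population residual `W - E_P(W | Z)`: it is `ε_P` for `W = X` and `ξ_P` for `W = Y`. -/
def noise {d : ℕ} (W : Obs d → ℝ) (P : ProbabilityMeasure (Obs d)) (o : Obs d) : ℝ :=
  W o - condMean W P (coordZ o)

/-- A regression method: for each sample size `n`, a map that turns the responses
`w_1, …, w_n` and the covariates `z_1, …, z_n` into an estimated regression function. -/
abbrev Regression (d : ℕ) : Type :=
  (n : ℕ) → (Fin n → ℝ) → (Fin n → Fin d → ℝ) → (Fin d → ℝ) → ℝ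

/-- The fitted values `ŵ(z_i)` are measurable functions of the data. -/
def Regression.IsMeasurable {d : ℕ} (h : Regression d) : Prop :=
  ∀ (n : ℕ) (i : Fin n),
    Measurable fun q : (Fin n → ℝ) × (Fin n → Fin d → ℝ) => h n q.1 q.2 (q.2 i)

/-- The value at `z_i` of the regression function obtained by regressing `W` on `Z`. -/
def fitted {d : ℕ} (W : Obs d → ℝ) (h : Regression d) {n : ℕ} (ω : Fin n → Obs d)
    (i : Fin n) : ℝ :=
  h n (fun j => W (ω j)) (fun j => coordZ (ω j)) (coordZ (ω i))

/-- The product of residuals `R_i = (x_i - f̂(z_i)) (y_i - ĝ(z_i))`. -/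
def residProd {d : ℕ} (fhat ghat : Regression d) {n : ℕ} (ω : Fin n → Obs d) (i : Fin n) : ℝ :=
  (coordX (ω i) - fitted coordX fhat ω i) * (coordY (ω i) - fitted coordY ghat ω i)

/-- The generalised covariance measure `T^(n)`. -/
def gcmStat {d : ℕ} (fhat ghat : Regression d) {n : ℕ} (ω : Fin n → Obs d) : ℝ :=
  (Real.sqrt n * ((1 / n : ℝ) * ∑ i, residProd fhat ghat ω i)) /
    Real.sqrt ((1 / n : ℝ) * ∑ i, residProd fhat ghat ω i ^ 2 -
      ((1 / n : ℝ) * ∑ i, residProd fhat ghat ω i) ^ 2)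

/-- The in-sample mean squared prediction error: `A_f` for `W = X` and `A_g` for `W = Y`. -/
def predErr {d : ℕ} (W : Obs d → ℝ) (h : Regression d) (P : ProbabilityMeasure (Obs d)) (n : ℕ)
    (ω : Fin n → Obs d) : ℝ :=
  (1 / n : ℝ) * ∑ i, (condMean W P (coordZ (ω i)) - fitted W h ω i) ^ 2

/-- The in-sample squared prediction error for `W`, weighted by the conditional variance of `W'`:
`B_f` for `(W, W') = (X, Y)` and `B_g` for `(W, W') = (Y, X)`. -/
def weightedPredErr {d : ℕ} (W W' : Obs d → ℝ) (h : Regression d) (P : ProbabilityMeasure (Obs d))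
    (n : ℕ) (ω : Fin n → Obs d) : ℝ≥0∞ :=
  (n : ℝ≥0∞)⁻¹ * ∑ i,
    ENNReal.ofReal ((condMean W P (coordZ (ω i)) - fitted W h ω i) ^ 2) *
      condVariance W' P (coordZ (ω i))

/-- `V_{P,n} = o_Ps(1)`: for every `ε > 0`, `sup_{P ∈ Ps} ℙ_P(|V_{P,n}| > ε) → 0`. The values may be
real numbers or elements of `[0, ∞]`. -/
def IsLittleOP {d : ℕ} {F : Type} [ENorm F] (Ps : Set (ProbabilityMeasure (Obs d)))
    (V : ProbabilityMeasure (Obs d) → (n : ℕ) → (Fin n → Obs d) → F) : Prop :=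
  ∀ ε : ℝ, 0 < ε →
    Tendsto (fun n : ℕ => ⨆ P ∈ Ps, sampleLaw P n {ω | ENNReal.ofReal ε < ‖V P n ω‖ₑ})
      atTop (𝓝 0)

/-- The conditions on the prediction errors, uniformly over `Ps`:
`A_f A_g = o_Ps(n⁻¹)`, `B_f = o_Ps(1)` and `B_g = o_Ps(1)`. -/
def PredictionConditions {d : ℕ} (fhat ghat : Regression d)
    (Ps : Set (ProbabilityMeasure (Obs d))) : Prop :=
  IsLittleOP Ps (fun P n ω => (n : ℝ) * (predErr coordX fhat P n ω * predErr coordY ghat P n ω)) ∧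
  IsLittleOP Ps (fun P n ω => weightedPredErr coordX coordY fhat P n ω) ∧
  IsLittleOP Ps (fun P n ω => weightedPredErr coordY coordX ghat P n ω)

/-- `E_P(|ε_P ξ_P|^r)`, a value in `[0, ∞]`. -/
def noiseMoment {d : ℕ} (P : ProbabilityMeasure (Obs d)) (r : ℝ) : ℝ≥0∞ :=
  ∫⁻ o, ENNReal.ofReal (|noise coordX P o * noise coordY P o| ^ r) ∂(P : Measure (Obs d))

/-- `sup_t |ℙ_P(T^(n) ≤ t) - Φ(t)|`, with `Φ` the standard normal distribution function. -/
def normalDist {d : ℕ} (fhat ghat : Regression d) (P : ProbabilityMeasure (Obs d)) (n : ℕ) :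
    ℝ≥0∞ :=
  ⨆ t : ℝ, ENNReal.ofReal
    |(sampleLaw P n).real {ω | gcmStat fhat ghat ω ≤ t} - cdf (gaussianReal 0 1) t|

end GCM

end

namespace GCM

/-! Write ε, ξ for the population residuals and a_i = f(z_i) - f̂(z_i), b_i = g(z_i) - ĝ(z_i) for
the prediction errors. Then R_i = (ε_i + a_i)(ξ_i + b_i) = ε_i ξ_i + a_i b_i + a_i ξ_i + b_i ε_i.
The products ε_i ξ_i are i.i.d. and, by conditional independence, centered; they produce the normal
limit, and the other three terms have to vanish.

By Cauchy–Schwarz, (n^{-1/2} Σ a_i b_i)² ≤ n A_f A_g. The a_i depend on the (x_j, z_j) only, and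
given these the ξ_i are centered and uncorrelated with variances v(z_i). Hence n^{-1/2} Σ a_i ξ_i
has conditional second moment B_f; by symmetry the last term has B_g. This is why no sample
splitting is needed. Conditioning on the data is replaced by redrawing one coordinate of the sample
(`measurePreserving_update_pi`). Since B_f is small only in probability, the weights are set to zero
where B_f is large before Chebyshev is applied (`CondCentered.measure_lt_abs_sum_le`).

The same bounds make the mean of (R_i - ε_i ξ_i)² negligible, so the empirical variance of the R_i
is consistent for E(ε²ξ²). Slutsky's theorem gives convergence at each t, and Pólya's theorem makes
it uniform in t.

A supremum over a class tends to zero once it does along every sequence of laws P_n in the class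
(`tendsto_iSup_of_forall_seq`). So all limit theorems are proved for triangular arrays whose row n
is i.i.d. from P_n, assuming that (εξ)² is uniformly integrable with mean bounded below. In (i) the
class is a singleton and integrability suffices; in (ii) the moment of order 2 + η gives uniform
integrability. -/

/-! ### Characteristic functions and the central limit theorem for triangular arrays -/

lemma norm_cexp_sub_taylor_le (x : ℝ) :
    ‖Complex.exp (x * Complex.I) - (1 + x * Complex.I - x ^ 2 / 2)‖ ≤ 4 * min (x ^ 2) (|x| ^ 3) := by
  -- For |x| ≤ 1 the cubic exponential remainder applies; for |x| ≥ 1 the triangle inequality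
  -- already gives (7/2) x², whence the constant 4.
  rcases le_total |x| 1 with hx | hx
  · have h := Complex.exp_bound (x := x * Complex.I) (by simpa using hx) (n := 3) (by norm_num)
    have e : ∑ m ∈ Finset.range 3, (x * Complex.I) ^ m / (m.factorial : ℂ)
        = 1 + x * Complex.I - x ^ 2 / 2 := by
      simp [Finset.sum_range_succ, mul_pow, Nat.factorial]
      ring
    rw [e] at h
    have h3 : |x| ^ 3 ≤ x ^ 2 := by
      rw [← sq_abs x]
      exact pow_le_pow_of_le_one (abs_nonneg x) hx (by norm_num)
    rw [min_eq_right h3]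
    refine h.trans ?_
    have : (0 : ℝ) ≤ |x| ^ 3 := by positivity
    simp [Nat.factorial]
    nlinarith
  · have h3 : x ^ 2 ≤ |x| ^ 3 := by
      rw [← sq_abs x]
      exact pow_le_pow_right₀ hx (by norm_num)
    rw [min_eq_left h3]
    have h1 : ‖Complex.exp (x * Complex.I)‖ = 1 := Complex.norm_exp_ofReal_mul_I x
    have h2 : ‖(1 + x * Complex.I - x ^ 2 / 2 : ℂ)‖ ≤ 1 + |x| + x ^ 2 / 2 := by
      refine (norm_sub_le _ _).trans ?_
      refine add_le_add ((norm_add_le _ _).trans ?_) ?_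
      · simp
      · simp
    refine (norm_sub_le _ _).trans ?_
    have : |x| ≤ x ^ 2 := by rw [← sq_abs x]; nlinarith
    have : 1 ≤ x ^ 2 := by linarith
    rw [h1]
    linarith

/-- Quantitative second order expansion of a characteristic function of a centered variable. -/
lemma norm_charFun_sub_le {Ω : Type*} {mΩ : MeasurableSpace Ω} {P : Measure Ω}
    [IsProbabilityMeasure P] {X : Ω → ℝ} (hX : Measurable X)
    (hX1 : Integrable X P) (hX2 : Integrable (fun ω => X ω ^ 2) P) (h0 : ∫ ω, X ω ∂P = 0)
    {M : ℝ} (hM : 0 ≤ M) (s : ℝ) :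
    ‖charFun (P.map X) s - ((1 - s ^ 2 * (∫ ω, X ω ^ 2 ∂P) / 2 : ℝ) : ℂ)‖ ≤
      4 * (s ^ 2 * (∫ ω in {ω | M < |X ω|}, X ω ^ 2 ∂P) + |s| ^ 3 * M * ∫ ω, X ω ^ 2 ∂P) := by
  have hE : Integrable (fun ω => Complex.exp ((s * X ω : ℝ) * Complex.I)) P := by
    refine Integrable.of_bound (C := 1) (by fun_prop) (ae_of_all _ fun ω => ?_)
    rw [Complex.norm_exp_ofReal_mul_I]
  have hA : MeasurableSet {ω | M < |X ω|} := measurableSet_lt measurable_const (by fun_prop)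
  have hX1c : Integrable (fun ω => ((s * X ω : ℝ) : ℂ) * Complex.I) P :=
    ((hX1.const_mul s).ofReal).mul_const _
  have hX2c : Integrable (fun ω => ((s * X ω : ℝ) : ℂ) ^ 2 / 2) P := by
    have := ((hX2.const_mul (s ^ 2)).ofReal (𝕜 := ℂ)).div_const 2
    refine this.congr (ae_of_all _ fun ω => ?_)
    simp [mul_pow]
  have hT : Integrable (fun ω => (1 + ((s * X ω : ℝ) : ℂ) * Complex.I
      - ((s * X ω : ℝ) : ℂ) ^ 2 / 2)) P :=
    ((integrable_const _).add hX1c).sub hX2c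
  have e2 : ∫ ω, (1 + ((s * X ω : ℝ) : ℂ) * Complex.I - ((s * X ω : ℝ) : ℂ) ^ 2 / 2) ∂P
      = ((1 - s ^ 2 * (∫ ω, X ω ^ 2 ∂P) / 2 : ℝ) : ℂ) := by
    rw [integral_sub (f := fun ω => 1 + ((s * X ω : ℝ) : ℂ) * Complex.I)
        ((integrable_const _).add hX1c) hX2c,
      integral_add (integrable_const _) hX1c, integral_mul_const, integral_div]
    have : (fun ω => ((s * X ω : ℝ) : ℂ) ^ 2) = fun ω => ((s ^ 2 * X ω ^ 2 : ℝ) : ℂ) := by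
      ext ω; push_cast; ring
    rw [this, integral_complex_ofReal, integral_complex_ofReal, integral_const_mul,
      integral_const_mul, h0]
    simp
  have e1 : charFun (P.map X) s = ∫ ω, Complex.exp ((s * X ω : ℝ) * Complex.I) ∂P := by
    rw [charFun_apply_real, integral_map hX.aemeasurable (by fun_prop)]
    simp
  rw [e1, ← e2, ← integral_sub hE hT]
  refine (norm_integral_le_integral_norm _).trans ?_
  -- Lindeberg splitting: the quadratic bound is used where |X| > M, and elsewhere the cubic one
  -- with |X|³ ≤ M X².
  have hbound : ∀ ω, ‖Complex.exp ((s * X ω : ℝ) * Complex.I) - (1 + ((s * X ω : ℝ) : ℂ) * Complex.I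
      - ((s * X ω : ℝ) : ℂ) ^ 2 / 2)‖ ≤
      4 * (s ^ 2 * ({ω | M < |X ω|}.indicator (fun ω => X ω ^ 2) ω) + |s| ^ 3 * M * X ω ^ 2) := by
    intro ω
    refine (norm_cexp_sub_taylor_le (s * X ω)).trans ?_
    refine mul_le_mul_of_nonneg_left ?_ (by norm_num)
    by_cases h : M < |X ω|
    · rw [Set.indicator_of_mem (show ω ∈ {ω | M < |X ω|} from h)]
      refine (min_le_left _ _).trans ?_
      rw [mul_pow]
      exact le_add_of_nonneg_right (by positivity)
    · rw [Set.indicator_of_notMem (show ω ∉ {ω | M < |X ω|} from h)]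
      refine (min_le_right _ _).trans ?_
      rw [abs_mul, mul_pow, mul_zero, zero_add, mul_assoc]
      refine mul_le_mul_of_nonneg_left ?_ (by positivity)
      rw [← sq_abs (X ω)]
      nlinarith [sq_nonneg |X ω|]
  refine (integral_mono (hE.sub hT).norm ?_ hbound).trans_eq ?_
  · exact (((hX2.indicator hA).const_mul _).add (hX2.const_mul _)).const_mul _
  · rw [integral_const_mul, integral_add ((hX2.indicator hA).const_mul _) (hX2.const_mul _),
      integral_const_mul, integral_const_mul, integral_indicator hA]

/-- The characteristic function of a scaled sum of i.i.d. variables. -/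
lemma charFun_map_pi_mul_sum {E : Type*} [MeasurableSpace E] (P : Measure E)
    [IsProbabilityMeasure P] {W : E → ℝ} (hW : Measurable W) (n : ℕ) (r u : ℝ) :
    charFun ((Measure.pi fun _ : Fin n => P).map fun ω => r * ∑ i, W (ω i)) u =
      (charFun (P.map W) (r * u)) ^ n := by
  have : IsProbabilityMeasure (P.map W) := Measure.isProbabilityMeasure_map hW.aemeasurable
  have hpi : (Measure.pi fun _ : Fin n => P).map (fun ω i => W (ω i)) =
      Measure.pi fun _ : Fin n => P.map W := Measure.pi_map_pi fun _ => hW.aemeasurable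
  have key := congrFun (charFun_map_sum_pi_eq_prod (E := ℝ) fun _ : Fin n => P.map W) (r * u)
  rw [← hpi, Measure.map_map (by fun_prop) (by fun_prop), Function.comp_def] at key
  rw [charFun_map_mul_comp (Measurable.aemeasurable (by fun_prop)), key]
  simp

/-- The Lindeberg-type estimate behind the central limit theorem. -/
lemma tendsto_charFun_pow_of_uniformIntegrable {E : Type*} [MeasurableSpace E] (P : ℕ → Measure E)
    [∀ n, IsProbabilityMeasure (P n)] {W : ℕ → E → ℝ} (hW : ∀ n, Measurable (W n))
    (h1 : ∀ n, Integrable (W n) (P n)) (h2 : ∀ n, Integrable (fun o => W n o ^ 2) (P n))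
    (h0 : ∀ n, ∫ o, W n o ∂(P n) = 0) {c : ℝ} (hc : 0 < c) {σ : ℕ → ℝ} (hσpos : ∀ n, 0 < σ n)
    (hσsq : ∀ n, σ n ^ 2 = ∫ o, W n o ^ 2 ∂(P n)) (hσc : ∀ n, c ≤ σ n)
    (hUI : ∀ δ > 0, ∃ M : ℝ, 0 ≤ M ∧ ∀ n, ∫ o in {o | M < |W n o|}, W n o ^ 2 ∂(P n) ≤ δ)
    (u : ℝ) :
    Tendsto (fun n : ℕ => (charFun ((P n).map (W n)) ((√n)⁻¹ / σ n * u)) ^ n) atTop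
      (𝓝 (Complex.exp (-(u ^ 2 / 2)))) := by
  -- It suffices that n(φ_n - 1) → -u²/2, since then φ_n^n = (1 + n(φ_n - 1)/n)^n converges to the
  -- exponential.
  have hg : Tendsto (fun n : ℕ => (n : ℂ) *
      (charFun ((P n).map (W n)) ((√n)⁻¹ / σ n * u) - 1)) atTop (𝓝 (-(u ^ 2 / 2))) := by
    rw [tendsto_iff_norm_sub_tendsto_zero, Metric.tendsto_atTop]
    intro ε hε
    -- With this tolerance the tail part is at most (ε/4) · u²/(u² + 1); the added 1 covers u = 0.
    -- For the fixed M the truncated part is of order n^{-1/2}.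
    obtain ⟨M, hM0, hM⟩ := hUI (c ^ 2 * ε / (16 * (u ^ 2 + 1))) (by positivity)
    have hsmall : Tendsto (fun n : ℕ => (4 * |u| ^ 3 * M / c) * (√n)⁻¹) atTop (𝓝 0) := by
      rw [← mul_zero (4 * |u| ^ 3 * M / c)]
      exact ((tendsto_inv_atTop_zero.comp Real.tendsto_sqrt_atTop).comp
        tendsto_natCast_atTop_atTop).const_mul _
    have hev := (hsmall.eventually (gt_mem_nhds (show (0 : ℝ) < ε / 2 by positivity))).and
      (eventually_gt_atTop 0)
    obtain ⟨N, hN⟩ := eventually_atTop.1 hev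
    refine ⟨N, fun n hn => ?_⟩
    obtain ⟨hn1, hn0⟩ := hN n hn
    have hn0' : (0 : ℝ) < n := by exact_mod_cast hn0
    have hsn : 0 < √(n : ℝ) := Real.sqrt_pos.2 hn0'
    have hsn2 : √(n : ℝ) ^ 2 = n := Real.sq_sqrt hn0'.le
    have hσ0 := hσpos n
    have hb := norm_charFun_sub_le (hW n) (h1 n) (h2 n) (h0 n) hM0 ((√n)⁻¹ / σ n * u)
    have hI := hM n
    have hIc : 0 ≤ ∫ o in {o | M < |W n o|}, W n o ^ 2 ∂(P n) :=
      integral_nonneg fun _ => sq_nonneg _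
    rw [← hσsq] at hb
    generalize ∫ o in {o | M < |W n o|}, W n o ^ 2 ∂(P n) = I at hb hI hIc
    generalize charFun ((P n).map (W n)) ((√n)⁻¹ / σ n * u) = φ at hb
    have hσn := hσc n
    generalize σ n = τ at hb hσ0 hσn
    generalize √(n : ℝ) = q at hb hsn hsn2 hn1
    have hs2 : n * (q⁻¹ / τ * u) ^ 2 = u ^ 2 / τ ^ 2 := by
      rw [← hsn2]
      field_simp
    have hs3 : n * (|q⁻¹ / τ * u| ^ 3 * M * τ ^ 2) = |u| ^ 3 * M / τ * q⁻¹ := by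
      rw [abs_mul, abs_of_pos (a := q⁻¹ / τ) (by positivity), ← hsn2]
      field_simp
    have e : (n : ℂ) * (φ - 1) - (-(u ^ 2 / 2)) =
        (n : ℂ) * (φ - ((1 - (q⁻¹ / τ * u) ^ 2 * τ ^ 2 / 2 : ℝ) : ℂ)) := by
      have h : n * (1 - (q⁻¹ / τ * u) ^ 2 * τ ^ 2 / 2) = n - u ^ 2 / 2 := by
        have : n * ((q⁻¹ / τ * u) ^ 2 * τ ^ 2) = u ^ 2 := by
          rw [← mul_assoc, hs2]; field_simp
        linarith
      have hC := congrArg (fun x : ℝ => (x : ℂ)) h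
      simp only [Complex.ofReal_mul (n : ℝ), Complex.ofReal_natCast] at hC
      rw [mul_sub, mul_sub, hC]
      push_cast
      ring
    rw [e, norm_mul, Complex.norm_natCast, dist_zero_right, Real.norm_of_nonneg (by positivity)]
    calc (n : ℝ) * _ ≤ n * (4 * ((q⁻¹ / τ * u) ^ 2 * I + |q⁻¹ / τ * u| ^ 3 * M * τ ^ 2)) :=
          mul_le_mul_of_nonneg_left hb hn0'.le
      _ = 4 * (u ^ 2 / τ ^ 2 * I) + 4 * (|u| ^ 3 * M / τ * q⁻¹) := by
          rw [← hs3, ← hs2]; ring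
      _ ≤ 4 * (u ^ 2 / c ^ 2 * (c ^ 2 * ε / (16 * (u ^ 2 + 1)))) +
          (4 * |u| ^ 3 * M / c) * q⁻¹ := by
          refine add_le_add (by gcongr) ?_
          have e4 : 4 * |u| ^ 3 * M / c * q⁻¹ = 4 * (|u| ^ 3 * M / c * q⁻¹) := by ring
          rw [e4]
          gcongr
      _ < ε / 2 + ε / 2 := by
          refine add_lt_add_of_le_of_lt ?_ hn1
          have : 4 * (u ^ 2 / c ^ 2 * (c ^ 2 * ε / (16 * (u ^ 2 + 1)))) =
            (ε / 4) * (u ^ 2 / (u ^ 2 + 1)) := by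
            field_simp; ring
          rw [this]
          have h1 : u ^ 2 / (u ^ 2 + 1) ≤ 1 := (div_le_one (by positivity)).2 (by linarith)
          nlinarith
      _ = ε := by ring
  simpa using Complex.tendsto_one_add_pow_exp_of_tendsto hg

/-- Lévy's continuity theorem for the standard normal limit, in terms of distribution functions. -/
lemma tendsto_real_Iic_of_tendsto_charFun (ν : ℕ → Measure ℝ) [∀ n, IsProbabilityMeasure (ν n)]
    (h : ∀ u : ℝ, Tendsto (fun n => charFun (ν n) u) atTop (𝓝 (Complex.exp (-(u ^ 2 / 2)))))
    (t : ℝ) :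
    Tendsto (fun n => (ν n).real (Set.Iic t)) atTop (𝓝 (cdf (gaussianReal 0 1) t)) := by
  let p : ℕ → ProbabilityMeasure ℝ := fun n => ⟨ν n, inferInstance⟩
  let γ : ProbabilityMeasure ℝ := ⟨gaussianReal 0 1, inferInstance⟩
  have hlim : Tendsto p atTop (𝓝 γ) := by
    refine ProbabilityMeasure.tendsto_of_tendsto_charFun fun u => ?_
    change Tendsto (fun n => charFun (ν n) u) atTop (𝓝 (charFun (gaussianReal 0 1) u))
    rw [charFun_gaussianReal]
    simpa using h u
  have hport := ProbabilityMeasure.tendsto_measure_of_null_frontier_of_tendsto' hlim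
    (E := Set.Iic t) (by
      have : NullSingletonClass (gaussianReal 0 1) := nullSingletonClass_gaussianReal (by norm_num)
      simp [γ])
  rw [cdf_eq_real]
  exact (ENNReal.tendsto_toReal (measure_ne_top _ _)).comp hport

/-- Central limit theorem for triangular arrays with i.i.d. rows whose squares are uniformly
integrable and whose variances are bounded away from zero. -/
theorem tendsto_pi_real_normalized_sum_le {E : Type*} [MeasurableSpace E] (P : ℕ → Measure E)
    [∀ n, IsProbabilityMeasure (P n)] {W : ℕ → E → ℝ} (hW : ∀ n, Measurable (W n))
    (h1 : ∀ n, Integrable (W n) (P n)) (h2 : ∀ n, Integrable (fun o => W n o ^ 2) (P n))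
    (h0 : ∀ n, ∫ o, W n o ∂(P n) = 0) {c : ℝ} (hc : 0 < c) {σ : ℕ → ℝ} (hσpos : ∀ n, 0 < σ n)
    (hσsq : ∀ n, σ n ^ 2 = ∫ o, W n o ^ 2 ∂(P n)) (hσc : ∀ n, c ≤ σ n)
    (hUI : ∀ δ > 0, ∃ M : ℝ, 0 ≤ M ∧ ∀ n, ∫ o in {o | M < |W n o|}, W n o ^ 2 ∂(P n) ≤ δ) (t : ℝ) :
    Tendsto (fun n : ℕ => (Measure.pi fun _ : Fin n => P n).real
      {ω | (√n)⁻¹ / σ n * (∑ i, W n (ω i)) ≤ t}) atTop (𝓝 (cdf (gaussianReal 0 1) t)) := by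
  have hSm : ∀ n : ℕ, Measurable fun ω : Fin n → E => (√n)⁻¹ / σ n * (∑ i, W n (ω i)) := by
    intro n
    have := hW n
    fun_prop
  have : ∀ n : ℕ, IsProbabilityMeasure ((Measure.pi fun _ : Fin n => P n).map
      fun ω => (√n)⁻¹ / σ n * (∑ i, W n (ω i))) := fun n =>
    Measure.isProbabilityMeasure_map (hSm n).aemeasurable
  refine (tendsto_real_Iic_of_tendsto_charFun (fun n => (Measure.pi fun _ : Fin n => P n).map
    fun ω => (√n)⁻¹ / σ n * (∑ i, W n (ω i))) (fun u => ?_) t).congr fun n => ?_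
  · exact (tendsto_charFun_pow_of_uniformIntegrable P hW h1 h2 h0 hc hσpos hσsq hσc hUI u).congr
      fun n => (charFun_map_pi_mul_sum (P n) (hW n) n _ u).symm
  · rw [map_measureReal_apply (hSm n) measurableSet_Iic]
    rfl

/-! ### Uniform convergence of distribution functions -/

/-- **Pólya's theorem**: pointwise convergence of monotone functions to a continuous distribution
function is uniform. -/
theorem tendsto_iSup_abs_sub_cdf {μ : Measure ℝ} [IsProbabilityMeasure μ]
    (hcont : Continuous (cdf μ)) {F : ℕ → ℝ → ℝ} (hmono : ∀ n, Monotone (F n))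
    (h01 : ∀ n t, F n t ∈ Set.Icc (0 : ℝ) 1)
    (hF : ∀ t, Tendsto (fun n => F n t) atTop (𝓝 (cdf μ t))) :
    Tendsto (fun n => ⨆ t : ℝ, ENNReal.ofReal |F n t - cdf μ t|) atTop (𝓝 0) := by
  suffices h : ∀ ε > 0, ∀ᶠ n in atTop, ∀ t, |F n t - cdf μ t| ≤ ε by
    rw [ENNReal.tendsto_atTop_zero]
    intro ε hε
    rcases eq_or_ne ε ∞ with rfl | hε'
    · exact ⟨0, fun _ _ => le_top⟩
    obtain ⟨N, hN⟩ := eventually_atTop.1 (h ε.toReal (ENNReal.toReal_pos hε.ne' hε'))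
    exact ⟨N, fun n hn => iSup_le fun t => ENNReal.ofReal_le_of_le_toReal (hN n hn t)⟩
  intro ε hε
  have hcm := monotone_cdf μ
  obtain ⟨a, ha⟩ := ((tendsto_cdf_atBot μ).eventually (gt_mem_nhds (half_pos hε))).exists
  obtain ⟨b, hb⟩ := ((tendsto_cdf_atTop μ).eventually
    (lt_mem_nhds (show 1 - ε / 2 < 1 by linarith))).exists
  -- Monotonicity sandwiches values at y near x between those at x ± δ/2, where pointwise
  -- convergence holds and the limit moves by less than ε/4.
  have hloc : ∀ x ∈ Set.Icc a b, ∀ᶠ p : ℕ × ℝ in atTop ×ˢ 𝓝 x, |F p.1 p.2 - cdf μ p.2| ≤ ε := by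
    intro x _
    obtain ⟨δ, hδ, hδ'⟩ := Metric.continuous_iff.1 hcont x (ε / 4) (by positivity)
    have hl := hδ' (x - δ / 2) (by rw [Real.dist_eq]; rw [abs_lt]; constructor <;> linarith)
    have hr := hδ' (x + δ / 2) (by rw [Real.dist_eq]; rw [abs_lt]; constructor <;> linarith)
    rw [Real.dist_eq, abs_lt] at hl hr
    have e1 := (hF (x - δ / 2)).eventually (lt_mem_nhds (show cdf μ (x - δ / 2) - ε / 4 < _ by linarith))
    have e2 := (hF (x + δ / 2)).eventually (gt_mem_nhds (show _ < cdf μ (x + δ / 2) + ε / 4 by linarith))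
    have e3 : ∀ᶠ y in 𝓝 x, y ∈ Set.Ioo (x - δ / 2) (x + δ / 2) :=
      Ioo_mem_nhds (by linarith) (by linarith)
    filter_upwards [(e1.and e2).prod_mk e3] with p ⟨⟨h1, h2⟩, h3⟩
    have m1 := hmono p.1 h3.1.le
    have m2 := hmono p.1 h3.2.le
    have m3 := hcm h3.1.le
    have m4 := hcm h3.2.le
    rw [abs_le]
    constructor <;> linarith
  have hmid : ∀ᶠ n in atTop, ∀ t ∈ Set.Icc a b, |F n t - cdf μ t| ≤ ε := by
    -- Compactness of [a, b] glues the local statements; outside [a, b], monotonicity and the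
    -- smallness of the limiting tails suffice.
    have h : ∀ᶠ p : ℕ × ℝ in atTop ×ˢ 𝓝ˢ (Set.Icc a b), |F p.1 p.2 - cdf μ p.2| ≤ ε := by
      simpa only [isCompact_Icc.prod_nhdsSet_eq_biSup, eventually_iSup] using hloc
    exact h.curry.mono fun _ h => h.self_of_nhdsSet
  filter_upwards [hmid, (hF a).eventually (gt_mem_nhds ha),
    (hF b).eventually (lt_mem_nhds hb)] with n hn1 hn2 hn3 t
  have := h01 n t
  have c0 := cdf_nonneg μ t
  have c1 := cdf_le_one μ t
  rcases lt_or_ge t a with hta | hta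
  · have := hmono n hta.le
    have := hcm hta.le
    rw [abs_le]; constructor <;> linarith [(h01 n t).1]
  rcases lt_or_ge b t with htb | htb
  · have := hmono n htb.le
    have := hcm htb.le
    rw [abs_le]; constructor <;> linarith [(h01 n t).2]
  exact hn1 t ⟨hta, htb⟩

/-- The jump of a distribution function at a point is the mass of that point, and the Gaussian has
no atoms. -/
lemma continuous_cdf_gaussianReal : Continuous (cdf (gaussianReal 0 1)) := by
  have : NullSingletonClass (gaussianReal 0 1) := nullSingletonClass_gaussianReal (by norm_num)
  refine continuous_iff_continuousAt.2 fun x => ?_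
  rw [(monotone_cdf _).continuousAt_iff_leftLim_eq_rightLim, StieltjesFunction.rightLim_eq]
  have h := (cdf (gaussianReal 0 1)).measure_singleton x
  rw [measure_cdf, measure_singleton, eq_comm, ENNReal.ofReal_eq_zero] at h
  exact le_antisymm ((monotone_cdf _).leftLim_le le_rfl) (by linarith)

/-! ### Sums of conditionally centered noise with data-dependent weights -/

/-- Redrawing one coordinate of an independent sample does not change its law. -/
lemma measurePreserving_update_pi {ι : Type*} [Fintype ι] [DecidableEq ι] {E : Type*}
    [MeasurableSpace E] (P : Measure E) [IsProbabilityMeasure P] (i : ι) :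
    MeasurePreserving (fun p : (ι → E) × E => Function.update p.1 i p.2)
      ((Measure.pi fun _ => P).prod P) (Measure.pi fun _ => P) := by
  have hm : Measurable fun p : (ι → E) × E => Function.update p.1 i p.2 := measurable_update'
  refine ⟨hm, (Measure.pi_eq fun s hs => ?_).symm⟩
  rw [Measure.map_apply hm (MeasurableSet.univ_pi hs)]
  -- The discarded i-th coordinate is unconstrained, hence the factor `Set.univ`, of mass one.
  have e : (fun p : (ι → E) × E => Function.update p.1 i p.2) ⁻¹' (Set.univ.pi s) =
      (Set.univ.pi (Function.update s i Set.univ)) ×ˢ s i := by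
    ext p
    simp only [Set.mem_preimage, Set.mem_pi, Set.mem_univ, true_imp_iff, Set.mem_prod]
    constructor
    · intro h
      refine ⟨fun j => ?_, by simpa using h i⟩
      by_cases hj : j = i
      · subst hj; simp
      · simpa [hj] using h j
    · rintro ⟨h1, h2⟩ j
      by_cases hj : j = i
      · subst hj; simpa using h2
      · simpa [hj] using h1 j
  rw [e, Measure.prod_prod, Measure.pi_pi, ← Finset.prod_erase_mul _ _ (Finset.mem_univ i),
    ← Finset.prod_erase_mul Finset.univ (fun j => P (s j)) (Finset.mem_univ i)]
  simp only [Function.update_self, measure_univ, mul_one]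
  congr 1
  refine Finset.prod_congr rfl fun j hj => ?_
  rw [Function.update_of_ne (Finset.ne_of_mem_erase hj)]

/-- The normalised conditional second moment of a weighted sum. -/
noncomputable def weightedMean {𝒰 : Type*} {n : ℕ} (w : 𝒰 → ℝ≥0∞) (a : Fin n → (Fin n → 𝒰) → ℝ) (u : Fin n → 𝒰) : ℝ≥0∞ :=
  (n : ℝ≥0∞)⁻¹ * ∑ i, ENNReal.ofReal (a i u ^ 2) * w (u i)

lemma measurable_weightedMean {𝒰 : Type*} [MeasurableSpace 𝒰] {n : ℕ} {w : 𝒰 → ℝ≥0∞} (hw : Measurable w) {a : Fin n → (Fin n → 𝒰) → ℝ}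
    (ha : ∀ i, Measurable (a i)) : Measurable (weightedMean w a) := by
  unfold weightedMean
  refine Measurable.const_mul (Finset.measurable_sum _ fun i _ => ?_) _
  exact ((ha i).pow_const 2).ennreal_ofReal.mul (hw.comp (measurable_pi_apply i))

/-- Zeroing all weights where their conditional second moment exceeds δ turns a bound in probability
into a sure one. -/
lemma weightedMean_indicator_le {𝒰 : Type*} {n : ℕ} (w : 𝒰 → ℝ≥0∞) (a : Fin n → (Fin n → 𝒰) → ℝ) (δ : ℝ≥0∞)
    (u : Fin n → 𝒰) :
    weightedMean w (fun i => {u | weightedMean w a u ≤ δ}.indicator (a i)) u ≤ δ := by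
  by_cases hu : u ∈ {u | weightedMean w a u ≤ δ}
  · refine le_trans (le_of_eq ?_) (show weightedMean w a u ≤ δ from hu)
    rw [weightedMean, weightedMean]
    simp only [Set.indicator_of_mem hu]
  · rw [weightedMean]
    simp only [Set.indicator_of_notMem hu]
    simp

/-- `V` has conditional mean zero and conditional second moment `w(U)` given `U`, expressed by
testing against measurable functions of `U`. -/
structure CondCentered {E 𝒰 : Type*} [MeasurableSpace E] [MeasurableSpace 𝒰] (P : Measure E)
    (U : E → 𝒰) (V : E → ℝ) (w : 𝒰 → ℝ≥0∞) : Prop where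
  measurable_left : Measurable U
  measurable_right : Measurable V
  measurable_weight : Measurable w
  -- Stated with values in [0, ∞], so that neither V nor w has to be integrable.
  lintegral_sq : ∀ h : 𝒰 → ℝ≥0∞, Measurable h →
    ∫⁻ o, h (U o) * ENNReal.ofReal (V o ^ 2) ∂P = ∫⁻ o, h (U o) * w (U o) ∂P
  integral_eq_zero : ∀ h : 𝒰 → ℝ, Measurable h → Integrable (fun o => h (U o) * V o) P →
    ∫ o, h (U o) * V o ∂P = 0

namespace CondCentered

variable {E 𝒰 : Type*} [MeasurableSpace E] [MeasurableSpace 𝒰] {P : Measure E}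
  {U : E → 𝒰} {V : E → ℝ} {w : 𝒰 → ℝ≥0∞} {n : ℕ}

lemma measurable_comp_pi (hV : CondCentered P U V w) :
    Measurable fun (ω : Fin n → E) j => U (ω j) := by
  have := hV.measurable_left
  fun_prop

variable [IsProbabilityMeasure P]

/-- Conditional second moment of one weighted term in the sample. -/
lemma lintegral_term_sq (hV : CondCentered P U V w) {a : (Fin n → 𝒰) → ℝ} (ha : Measurable a)
    (i : Fin n) :
    ∫⁻ ω, ENNReal.ofReal ((a (fun j => U (ω j)) * V (ω i)) ^ 2) ∂(Measure.pi fun _ => P) =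
      ∫⁻ ω, ENNReal.ofReal (a (fun j => U (ω j)) ^ 2) * w (U (ω i)) ∂(Measure.pi fun _ => P) := by
  have hU := hV.measurable_left
  have hVm := hV.measurable_right
  have hw := hV.measurable_weight
  have hmp := measurePreserving_update_pi (ι := Fin n) P i
  have hUp : Measurable fun (ω : Fin n → E) j => U (ω j) := hV.measurable_comp_pi
  have hm : Measurable fun p : (Fin n → E) × E => Function.update p.1 i p.2 := hmp.measurable
  have m1 : Measurable fun ω : Fin n → E =>
      ENNReal.ofReal ((a (fun j => U (ω j)) * V (ω i)) ^ 2) := by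
    have := ha.comp hUp
    have h2 : Measurable fun ω : Fin n → E => V (ω i) := by fun_prop
    exact ((this.mul h2).pow_const 2).ennreal_ofReal
  have m2 : Measurable fun ω : Fin n → E =>
      ENNReal.ofReal (a (fun j => U (ω j)) ^ 2) * w (U (ω i)) := by
    have := ha.comp hUp
    have h2 : Measurable fun ω : Fin n → E => w (U (ω i)) := by fun_prop
    exact (this.pow_const 2).ennreal_ofReal.mul h2
  -- Redraw observation i and integrate over it first: with the others frozen, the weight is a
  -- function of U at the new observation alone.
  rw [← hmp.lintegral_comp m1, ← hmp.lintegral_comp m2]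
  refine (lintegral_prod _ (m1.comp hm).aemeasurable).trans
    (Eq.trans ?_ (lintegral_prod _ (m2.comp hm).aemeasurable).symm)
  refine lintegral_congr fun ω => ?_
  have key : ∀ o, (fun j => U (Function.update ω i o j)) =
      Function.update (fun j => U (ω j)) i (U o) := by
    intro o
    ext j
    by_cases hj : j = i
    · subst hj; simp
    · simp [hj]
  simp only [Function.comp_apply, key, Function.update_self, mul_pow]
  have hh := hV.lintegral_sq
    (fun u => ENNReal.ofReal (a (Function.update (fun j => U (ω j)) i u) ^ 2))
    ((ha.comp (measurable_update _)).pow_const 2).ennreal_ofReal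
  rw [← hh]
  refine lintegral_congr fun o => ?_
  rw [ENNReal.ofReal_mul (sq_nonneg _)]

/-- Distinct weighted terms in the sample are uncorrelated. -/
lemma integral_term_mul_term (hV : CondCentered P U V w) {a : (Fin n → 𝒰) → ℝ} (ha : Measurable a)
    {i k : Fin n} (hik : k ≠ i)
    (hint : Integrable (fun ω => a (fun j => U (ω j)) * V (ω k) * V (ω i))
      (Measure.pi fun _ => P)) :
    ∫ ω, a (fun j => U (ω j)) * V (ω k) * V (ω i) ∂(Measure.pi fun _ => P) = 0 := by
  have hmp := measurePreserving_update_pi (ι := Fin n) P i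
  have hint2 := hmp.integrable_comp_of_integrable hint
  have e : ∫ ω, a (fun j => U (ω j)) * V (ω k) * V (ω i) ∂(Measure.pi fun _ => P) =
      ∫ p, ((fun ω => a (fun j => U (ω j)) * V (ω k) * V (ω i)) ∘
        fun p : (Fin n → E) × E => Function.update p.1 i p.2) p
        ∂((Measure.pi fun _ => P).prod P) := by
    have h := integral_map hmp.aemeasurable (f := fun ω => a (fun j => U (ω j)) * V (ω k) * V (ω i))
      (by rw [hmp.map_eq]; exact hint.aestronglyMeasurable)
    rwa [hmp.map_eq] at h
  rw [e, integral_prod _ hint2]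
  refine integral_eq_zero_of_ae ?_
  filter_upwards [hint2.prod_right_ae] with ω hω
  have key : ∀ o, (fun j => U (Function.update ω i o j)) =
      Function.update (fun j => U (ω j)) i (U o) := by
    intro o
    ext j
    by_cases hj : j = i
    · subst hj; simp
    · simp [hj]
  simp only [Function.comp_apply, key, Function.update_self, Function.update_of_ne hik] at hω ⊢
  -- As k ≠ i, the factor V(ω k) is frozen while observation i is redrawn, so it can be absorbed
  -- into the test function.
  exact hV.integral_eq_zero (fun u => a (Function.update (fun j => U (ω j)) i u) * V (ω k))
    ((ha.comp (measurable_update _)).mul_const _) hω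

/-- Conditional second moment bound for a weighted sum whose weights depend on `U` only. -/
lemma lintegral_sum_sq_le (hV : CondCentered P U V w) {a : Fin n → (Fin n → 𝒰) → ℝ}
    (ha : ∀ i, Measurable (a i)) :
    ∫⁻ ω, ENNReal.ofReal ((∑ i, a i (fun j => U (ω j)) * V (ω i)) ^ 2) ∂(Measure.pi fun _ => P) ≤
      ∫⁻ ω, ∑ i, ENNReal.ofReal (a i (fun j => U (ω j)) ^ 2) * w (U (ω i))
        ∂(Measure.pi fun _ => P) := by
  have hU := hV.measurable_left
  have hVm := hV.measurable_right
  have hw := hV.measurable_weight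
  have hUp : Measurable fun (ω : Fin n → E) j => U (ω j) := hV.measurable_comp_pi
  have hau : ∀ i, Measurable fun ω : Fin n → E => a i (fun j => U (ω j)) :=
    fun i => (ha i).comp hUp
  have hVi : ∀ i, Measurable fun ω : Fin n → E => V (ω i) := fun i => by fun_prop
  have hterm : ∀ i, Measurable fun ω : Fin n → E => a i (fun j => U (ω j)) * V (ω i) :=
    fun i => (hau i).mul (hVi i)
  have hterm' : ∀ i, Measurable fun ω : Fin n → E =>
      ENNReal.ofReal (a i (fun j => U (ω j)) ^ 2) * w (U (ω i)) := fun i =>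
    ((hau i).pow_const 2).ennreal_ofReal.mul (by fun_prop)
  rw [lintegral_finsetSum _ fun i _ => hterm' i]
  simp_rw [← hV.lintegral_term_sq (ha _)]
  -- If every term is square integrable, the off-diagonal expectations vanish; otherwise the
  -- right-hand side is infinite.
  by_cases hfin : ∀ i, ∫⁻ ω, ENNReal.ofReal ((a i (fun j => U (ω j)) * V (ω i)) ^ 2)
      ∂(Measure.pi fun _ => P) ≠ ∞
  · have hL2 : ∀ i, MemLp (fun ω : Fin n → E => a i (fun j => U (ω j)) * V (ω i)) 2
        (Measure.pi fun _ => P) := by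
      intro i
      rw [memLp_two_iff_integrable_sq (hterm i).aestronglyMeasurable]
      refine ⟨((hterm i).pow_const 2).aestronglyMeasurable, ?_⟩
      rw [hasFiniteIntegral_iff_ofReal (ae_of_all _ fun _ => sq_nonneg _)]
      exact (hfin i).lt_top
    have hprod : ∀ i k, Integrable (fun ω : Fin n → E => (a i (fun j => U (ω j)) * V (ω i)) *
        (a k (fun j => U (ω j)) * V (ω k))) (Measure.pi fun _ => P) :=
      fun i k => (hL2 i).integrable_mul (hL2 k)
    have hsum : MemLp (fun ω : Fin n → E => ∑ i, a i (fun j => U (ω j)) * V (ω i)) 2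
        (Measure.pi fun _ => P) := memLp_finsetSum _ fun i _ => hL2 i
    rw [← ofReal_integral_eq_lintegral_ofReal hsum.integrable_sq (ae_of_all _ fun _ => sq_nonneg _)]
    simp_rw [← ofReal_integral_eq_lintegral_ofReal (hL2 _).integrable_sq
      (ae_of_all _ fun _ => sq_nonneg _)]
    rw [← ENNReal.ofReal_sum_of_nonneg fun i _ => integral_nonneg fun _ => sq_nonneg _]
    refine ENNReal.ofReal_le_ofReal (le_of_eq ?_)
    simp_rw [sq (∑ i, _), Finset.sum_mul_sum]
    rw [integral_finsetSum _ fun i _ => integrable_finsetSum _ fun k _ => hprod i k]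
    refine Finset.sum_congr rfl fun i _ => ?_
    rw [integral_finsetSum _ fun k _ => hprod i k, Finset.sum_eq_single i]
    · simp_rw [sq]
    · intro k _ hk
      have := hV.integral_term_mul_term (a := fun u => a i u * a k u) ((ha i).mul (ha k)) hk
      have e : ∀ ω : Fin n → E, (a i (fun j => U (ω j)) * V (ω i)) *
          (a k (fun j => U (ω j)) * V (ω k)) =
          a i (fun j => U (ω j)) * a k (fun j => U (ω j)) * V (ω k) * V (ω i) := fun ω => by ring
      simp_rw [e]
      refine this ?_
      simpa only [e] using hprod i k
    · simp
  · push Not at hfin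
    obtain ⟨i, hi⟩ := hfin
    rw [(ENNReal.sum_eq_top).2 ⟨i, Finset.mem_univ i, hi⟩]
    exact le_top

/-- The expected weighted mean of squares is the expected normalised conditional second moment. -/
lemma lintegral_mean_term_sq (hV : CondCentered P U V w) {a : Fin n → (Fin n → 𝒰) → ℝ}
    (ha : ∀ i, Measurable (a i)) :
    ∫⁻ ω, (n : ℝ≥0∞)⁻¹ * ∑ i, ENNReal.ofReal ((a i (fun j => U (ω j)) * V (ω i)) ^ 2)
      ∂(Measure.pi fun _ => P) =
    ∫⁻ ω, weightedMean w a (fun j => U (ω j)) ∂(Measure.pi fun _ => P) := by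
  have hau : ∀ i, Measurable fun ω : Fin n → E => a i (fun j => U (ω j)) :=
    fun i => (ha i).comp hV.measurable_comp_pi
  have hterm : ∀ i, Measurable fun ω : Fin n → E =>
      ENNReal.ofReal ((a i (fun j => U (ω j)) * V (ω i)) ^ 2) := fun i =>
    (((hau i).mul (hV.measurable_right.comp (measurable_pi_apply i))).pow_const 2).ennreal_ofReal
  have hterm' : ∀ i, Measurable fun ω : Fin n → E =>
      ENNReal.ofReal (a i (fun j => U (ω j)) ^ 2) * w (U (ω i)) := fun i =>
    ((hau i).pow_const 2).ennreal_ofReal.mul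
      (hV.measurable_weight.comp (hV.measurable_left.comp (measurable_pi_apply i)))
  unfold weightedMean
  rw [lintegral_const_mul _ (Finset.measurable_sum _ fun i _ => hterm i),
    lintegral_finsetSum _ fun i _ => hterm i,
    lintegral_const_mul _ (Finset.measurable_sum _ fun i _ => hterm' i),
    lintegral_finsetSum _ fun i _ => hterm' i]
  congr 1
  exact Finset.sum_congr rfl fun i _ => hV.lintegral_term_sq (ha i) i

/-- Conditional Chebyshev inequality after truncating the conditional second moment. -/
lemma measure_lt_abs_sum_le (hV : CondCentered P U V w) {a : Fin n → (Fin n → 𝒰) → ℝ}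
    (ha : ∀ i, Measurable (a i)) {ε : ℝ} (hε : 0 < ε) (δ : ℝ≥0∞) :
    (Measure.pi fun _ => P) {ω | ε < |(√n)⁻¹ * ∑ i, a i (fun j => U (ω j)) * V (ω i)|} ≤
      (Measure.pi fun _ => P) {ω | δ < weightedMean w a (fun j => U (ω j))} +
      δ / ENNReal.ofReal (ε ^ 2) := by
  rcases Nat.eq_zero_or_pos n with rfl | hn
  · simp [hε.not_gt]
  have hn' : (0 : ℝ) < n := by exact_mod_cast hn
  -- The truncation event is determined by the U-values, so the truncated weights still depend on U
  -- only and the second moment bound applies to them.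
  set a' : Fin n → (Fin n → 𝒰) → ℝ := fun i => {u | weightedMean w a u ≤ δ}.indicator (a i) with ha'
  have ha'm : ∀ i, Measurable (a' i) := fun i => (ha i).indicator
    (measurableSet_le (measurable_weightedMean hV.measurable_weight ha) measurable_const)
  have hsub : {ω : Fin n → E | ε < |(√n)⁻¹ * ∑ i, a i (fun j => U (ω j)) * V (ω i)|} ⊆
      {ω | δ < weightedMean w a (fun j => U (ω j))} ∪
      {ω | ENNReal.ofReal (ε ^ 2) ≤
        ENNReal.ofReal ((∑ i, ((√n)⁻¹ * a' i (fun j => U (ω j))) * V (ω i)) ^ 2)} := by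
    intro ω hω
    by_cases h : weightedMean w a (fun j => U (ω j)) ≤ δ
    · right
      have e : ∀ i, a' i (fun j => U (ω j)) = a i (fun j => U (ω j)) := fun i =>
        Set.indicator_of_mem (show (fun j => U (ω j)) ∈ {u | weightedMean w a u ≤ δ} from h) _
      simp only [Set.mem_ofPred_eq, e, mul_assoc, ← Finset.mul_sum] at hω ⊢
      refine ENNReal.ofReal_le_ofReal ?_
      rw [← sq_abs ((√n)⁻¹ * _)]
      exact pow_le_pow_left₀ hε.le (le_of_lt hω) 2
    · left
      exact not_le.1 h
  refine (measure_mono hsub).trans ((measure_union_le _ _).trans (add_le_add le_rfl ?_))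
  have hterm : Measurable fun ω : Fin n → E =>
      ENNReal.ofReal ((∑ i, ((√n)⁻¹ * a' i (fun j => U (ω j))) * V (ω i)) ^ 2) := by
    refine ((Finset.measurable_sum _ fun i _ => ?_).pow_const 2).ennreal_ofReal
    exact (((ha'm i).comp hV.measurable_comp_pi).const_mul _).mul
      (hV.measurable_right.comp (measurable_pi_apply i))
  refine (meas_ge_le_lintegral_div hterm.aemeasurable
    (ENNReal.ofReal_pos.2 (by positivity)).ne' ENNReal.ofReal_ne_top).trans ?_
  refine ENNReal.div_le_div_right ?_ _
  refine (hV.lintegral_sum_sq_le (a := fun i u => (√n)⁻¹ * a' i u)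
    fun i => (ha'm i).const_mul _).trans ?_
  have hle : ∀ ω : Fin n → E, ∑ i, ENNReal.ofReal (((√n)⁻¹ * a' i (fun j => U (ω j))) ^ 2) *
      w (U (ω i)) ≤ δ := by
    intro ω
    refine le_trans (le_of_eq ?_) (weightedMean_indicator_le w a δ (fun j => U (ω j)))
    rw [weightedMean, Finset.mul_sum]
    refine Finset.sum_congr rfl fun i _ => ?_
    rw [mul_pow, inv_pow, Real.sq_sqrt hn'.le, ENNReal.ofReal_mul (by positivity),
      ENNReal.ofReal_inv_of_pos hn', ENNReal.ofReal_natCast, mul_assoc]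
  refine (lintegral_mono hle).trans ?_
  simp

/-- Conditional Markov inequality after truncating the conditional second moment. -/
lemma measure_lt_mean_sq_le (hV : CondCentered P U V w) {a : Fin n → (Fin n → 𝒰) → ℝ}
    (ha : ∀ i, Measurable (a i)) {ε : ℝ} (hε : 0 < ε) (δ : ℝ≥0∞) :
    (Measure.pi fun _ => P) {ω | ε < (1 / n : ℝ) * ∑ i, (a i (fun j => U (ω j)) * V (ω i)) ^ 2} ≤
      (Measure.pi fun _ => P) {ω | δ < weightedMean w a (fun j => U (ω j))} +
      δ / ENNReal.ofReal ε := by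
  rcases Nat.eq_zero_or_pos n with rfl | hn
  · simp [hε.not_gt]
  have hn' : (0 : ℝ) < n := by exact_mod_cast hn
  set a' : Fin n → (Fin n → 𝒰) → ℝ := fun i => {u | weightedMean w a u ≤ δ}.indicator (a i) with ha'
  have ha'm : ∀ i, Measurable (a' i) := fun i => (ha i).indicator
    (measurableSet_le (measurable_weightedMean hV.measurable_weight ha) measurable_const)
  have hsub : {ω : Fin n → E | ε < (1 / n : ℝ) * ∑ i, (a i (fun j => U (ω j)) * V (ω i)) ^ 2} ⊆
      {ω | δ < weightedMean w a (fun j => U (ω j))} ∪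
      {ω | ENNReal.ofReal ε ≤ (n : ℝ≥0∞)⁻¹ *
        ∑ i, ENNReal.ofReal ((a' i (fun j => U (ω j)) * V (ω i)) ^ 2)} := by
    intro ω hω
    by_cases h : weightedMean w a (fun j => U (ω j)) ≤ δ
    · right
      have e : ∀ i, a' i (fun j => U (ω j)) = a i (fun j => U (ω j)) := fun i =>
        Set.indicator_of_mem (show (fun j => U (ω j)) ∈ {u | weightedMean w a u ≤ δ} from h) _
      simp only [Set.mem_ofPred_eq, e] at hω ⊢
      rw [← ENNReal.ofReal_sum_of_nonneg fun i _ => sq_nonneg _, ← ENNReal.ofReal_natCast,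
        ← ENNReal.ofReal_inv_of_pos hn', ← ENNReal.ofReal_mul (by positivity)]
      refine ENNReal.ofReal_le_ofReal ?_
      rw [← one_div]
      exact hω.le
    · left
      exact not_le.1 h
  refine (measure_mono hsub).trans ((measure_union_le _ _).trans (add_le_add le_rfl ?_))
  have hterm : ∀ i, Measurable fun ω : Fin n → E =>
      ENNReal.ofReal ((a' i (fun j => U (ω j)) * V (ω i)) ^ 2) := by
    intro i
    have h1 : Measurable fun ω : Fin n → E => a' i (fun j => U (ω j)) :=
      (ha'm i).comp hV.measurable_comp_pi
    have h2 : Measurable fun ω : Fin n → E => V (ω i) :=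
      hV.measurable_right.comp (measurable_pi_apply i)
    exact ((h1.mul h2).pow_const 2).ennreal_ofReal
  have hmean : Measurable fun ω : Fin n → E => (n : ℝ≥0∞)⁻¹ *
      ∑ i, ENNReal.ofReal ((a' i (fun j => U (ω j)) * V (ω i)) ^ 2) :=
    Measurable.const_mul (Finset.measurable_sum _ fun i _ => hterm i) _
  have hmark := meas_ge_le_lintegral_div (μ := Measure.pi fun _ : Fin n => P)
    hmean.aemeasurable (ENNReal.ofReal_pos.2 hε).ne' ENNReal.ofReal_ne_top
  rw [hV.lintegral_mean_term_sq ha'm] at hmark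
  refine hmark.trans (ENNReal.div_le_div_right ?_ _)
  have hle : ∀ ω : Fin n → E, weightedMean w a' (fun j => U (ω j)) ≤ δ := fun ω =>
    weightedMean_indicator_le w a δ (fun j => U (ω j))
  refine (lintegral_mono hle).trans ?_
  simp

end CondCentered

/-! ### Population residuals under the null hypothesis -/

variable {d : ℕ}

lemma measurable_coordX : Measurable (coordX (d := d)) := measurable_fst

lemma measurable_coordY : Measurable (coordY (d := d)) := measurable_fst.comp measurable_snd

lemma measurable_condMean (W : Obs d → ℝ) (P : ProbabilityMeasure (Obs d)) :
    Measurable (condMean W P) := by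
  have : StronglyMeasurable fun z : Fin d → ℝ =>
      ∫ y, y ∂(condDistrib W coordZ (P : Measure (Obs d)) z) :=
    StronglyMeasurable.integral_kernel_prod_right' (f := fun p : (Fin d → ℝ) × ℝ => p.2)
      (by fun_prop)
  exact this.measurable

lemma measurable_condVariance (W : Obs d → ℝ) (P : ProbabilityMeasure (Obs d)) :
    Measurable (condVariance W P) := by
  have hm := measurable_condMean W P
  exact Measurable.lintegral_kernel_prod_right'
    (κ := condDistrib W coordZ (P : Measure (Obs d)))
    (f := fun p : (Fin d → ℝ) × ℝ => ENNReal.ofReal ((p.2 - condMean W P p.1) ^ 2))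
    (by fun_prop)

lemma measurable_noise {W : Obs d → ℝ} (hW : Measurable W) (P : ProbabilityMeasure (Obs d)) :
    Measurable (noise W P) :=
  hW.sub ((measurable_condMean W P).comp measurable_coordZ)

/-- Under conditional independence, the noise of `W` is centered given `Z` and the other response,
with conditional second moment depending on `Z` only. -/
theorem condCentered_noise {P : ProbabilityMeasure (Obs d)} {W W' : Obs d → ℝ}
    (hW : Measurable W) (hW' : Measurable W')
    (hci : CondIndepFun (MeasurableSpace.comap (coordZ (d := d)) inferInstance)
      measurable_coordZ.comap_le W' W (P : Measure (Obs d)))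
    (hmean : HasCondMean W P) :
    CondCentered (P : Measure (Obs d)) (fun o => (coordZ o, W' o)) (noise W P)
      (fun u => condVariance W P u.1) := by
  have hZ := measurable_coordZ (d := d)
  have hm := measurable_condMean W P
  have hv := measurable_condVariance W P
  have hU : Measurable fun o : Obs d => (coordZ o, W' o) := hZ.prodMk hW'
  have hn := measurable_noise hW P
  -- Conditional independence enters here: the conditional law of W given (Z, W') is that given Z
  -- alone.
  have hlaw : (P : Measure (Obs d)).map (fun o => ((coordZ o, W' o), W o)) =
      ((P : Measure (Obs d)).map fun o => (coordZ o, W' o)) ⊗ₘ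
        (condDistrib W coordZ (P : Measure (Obs d))).prodMkRight ℝ := by
    rw [← compProd_map_condDistrib hW.aemeasurable]
    exact Measure.compProd_congr
      ((condIndepFun_iff_condDistrib_prod_ae_eq_prodMkRight hW hW' hZ).1 hci)
  have hpair : Measurable fun o : Obs d => ((coordZ o, W' o), W o) := hU.prodMk hW
  refine ⟨hU, hn, by fun_prop, fun h hh => ?_, fun h hh hint => ?_⟩
  · have m1 : Measurable fun p : ((Fin d → ℝ) × ℝ) × ℝ =>
        h p.1 * ENNReal.ofReal ((p.2 - condMean W P p.1.1) ^ 2) := by fun_prop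
    have e1 := lintegral_map (μ := (P : Measure (Obs d))) m1 hpair
    have m2 : Measurable fun u : (Fin d → ℝ) × ℝ => h u * condVariance W P u.1 := by fun_prop
    have e2 := lintegral_map (μ := (P : Measure (Obs d))) m2 hU
    refine e1.symm.trans (Eq.trans ?_ e2)
    rw [hlaw, Measure.lintegral_compProd m1]
    refine lintegral_congr fun u => ?_
    have m3 : Measurable fun y : ℝ => ENNReal.ofReal ((y - condMean W P u.1) ^ 2) := by fun_prop
    change ∫⁻ y, h u * ENNReal.ofReal ((y - condMean W P u.1) ^ 2) ∂(condLaw W P u.1) = _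
    rw [lintegral_const_mul _ m3]
    rfl
  · have m1 : Measurable fun p : ((Fin d → ℝ) × ℝ) × ℝ =>
        h p.1 * (p.2 - condMean W P p.1.1) := by fun_prop
    have e1 := integral_map (μ := (P : Measure (Obs d))) hpair.aemeasurable
      m1.aestronglyMeasurable
    refine e1.symm.trans ?_
    have hint2 := (integrable_map_measure (μ := (P : Measure (Obs d)))
      m1.aestronglyMeasurable hpair.aemeasurable).2 hint
    rw [hlaw] at hint2 ⊢
    rw [Measure.integral_compProd hint2]
    refine integral_eq_zero_of_ae ?_
    have hmean' : ∀ᵐ u ∂((P : Measure (Obs d)).map fun o => (coordZ o, W' o)),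
        Integrable (fun w : ℝ => w) (condLaw W P u.1) := by
      have hfst : ((P : Measure (Obs d)).map fun o => (coordZ o, W' o)).map Prod.fst =
          (P : Measure (Obs d)).map coordZ := by
        rw [Measure.map_map measurable_fst hU]
        rfl
      rw [HasCondMean, ← hfst] at hmean
      exact ae_of_ae_map measurable_fst.aemeasurable hmean
    filter_upwards [hmean'] with u hu
    rw [integral_const_mul]
    have : IsProbabilityMeasure (condLaw W P u.1) := by unfold condLaw; infer_instance
    have hz : ∫ y, (y - condMean W P u.1) ∂(condLaw W P u.1) = 0 := by
      rw [integral_sub hu (integrable_const _)]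
      simp [condMean]
    change h u * ∫ y, (y - condMean W P u.1) ∂(condLaw W P u.1) = 0
    rw [hz, mul_zero]

/-! ### Convergence in probability -/

/-- Convergence to zero in probability along a sequence of measure spaces. -/
def TendstoZeroInProb {Ω : ℕ → Type*} {mΩ : ∀ n, MeasurableSpace (Ω n)}
    (μ : ∀ n, Measure (Ω n)) (V : ∀ n, Ω n → ℝ) : Prop :=
  ∀ ε > 0, Tendsto (fun n => μ n {ω | ε < |V n ω|}) atTop (𝓝 0)

namespace TendstoZeroInProb

variable {Ω : ℕ → Type*} {mΩ : ∀ n, MeasurableSpace (Ω n)} {μ : ∀ n, Measure (Ω n)}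

/-- A quantity that is small as soon as finitely many sequences converging to zero in probability
are small converges to zero in probability. -/
lemma of_finite {ι : Type*} [Fintype ι] {V : ι → ∀ n, Ω n → ℝ} {V' : ∀ n, Ω n → ℝ}
    (hV : ∀ k, TendstoZeroInProb μ (V k))
    (h : ∀ ε > 0, ∃ δ > 0, ∀ᶠ n in atTop, ∀ ω, (∀ k, |V k n ω| ≤ δ) → |V' n ω| ≤ ε) :
    TendstoZeroInProb μ V' := by
  intro ε hε
  obtain ⟨δ, hδ, hev⟩ := h ε hε
  have hsum : Tendsto (fun n => ∑ k, μ n {ω | δ < |V k n ω|}) atTop (𝓝 0) := by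
    simpa using tendsto_finsetSum Finset.univ fun k _ => hV k δ hδ
  refine tendsto_of_tendsto_of_tendsto_of_le_of_le' tendsto_const_nhds hsum
    (Eventually.of_forall fun _ => zero_le) ?_
  filter_upwards [hev] with n hn
  have hsub : {ω | ε < |V' n ω|} ⊆ ⋃ k ∈ (Finset.univ : Finset ι), {ω | δ < |V k n ω|} := by
    intro ω hω
    by_contra hcon
    simp only [Set.mem_iUnion, Set.mem_ofPred_eq, not_exists, not_lt, Finset.mem_univ,
      forall_const] at hcon
    exact absurd (hn ω hcon) (not_le.2 hω)
  exact (measure_mono hsub).trans (measure_biUnion_finset_le _ _)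

/-- Convergence in probability from bounds `μ {ε < |V|} ≤ b + η` with `b → 0`, for each tolerance
`η`. -/
lemma of_le_add {V : ∀ n, Ω n → ℝ}
    (h : ∀ ε > 0, ∀ η : ℝ≥0∞, 0 < η → ∃ b : ℕ → ℝ≥0∞, Tendsto b atTop (𝓝 0) ∧
      ∀ᶠ n in atTop, μ n {ω | ε < |V n ω|} ≤ b n + η) :
    TendstoZeroInProb μ V := by
  intro ε hε
  rw [ENNReal.tendsto_nhds_zero]
  intro η hη
  obtain ⟨b, hb, hle⟩ := h ε hε (η / 2) (ENNReal.half_pos hη.ne')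
  filter_upwards [hle, (ENNReal.tendsto_nhds_zero.1 hb) (η / 2) (ENNReal.half_pos hη.ne')]
    with n h1 h2
  exact h1.trans ((add_le_add h2 le_rfl).trans (ENNReal.add_halves η).le)

end TendstoZeroInProb

/-- A positive real `δ ≤ ε` such that `δ / ε` is below a given tolerance. -/
lemma exists_ofReal_div_le {ε : ℝ} (hε : 0 < ε) {η : ℝ≥0∞} (hη : 0 < η) :
    ∃ δ : ℝ, 0 < δ ∧ δ ≤ ε ∧ ENNReal.ofReal δ / ENNReal.ofReal ε ≤ η := by
  rcases eq_or_ne η ∞ with rfl | hη'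
  · exact ⟨ε, hε, le_rfl, le_top⟩
  have hηr := ENNReal.toReal_pos hη.ne' hη'
  refine ⟨min ε (η.toReal * ε), by positivity, min_le_left _ _, ?_⟩
  rw [ENNReal.div_le_iff (ENNReal.ofReal_pos.2 hε).ne' ENNReal.ofReal_ne_top]
  refine (ENNReal.ofReal_le_ofReal (min_le_right _ _)).trans_eq ?_
  rw [ENNReal.ofReal_mul hηr.le, ENNReal.ofReal_toReal hη']

/-! ### Laws of large numbers for triangular arrays -/

section Sample

variable {E : Type*} [MeasurableSpace E]

/-- A square integrable centered variable is `CondCentered` given a trivial variable. -/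
lemma condCentered_unit {P : Measure E} [IsProbabilityMeasure P] {V : E → ℝ} (hV : Measurable V)
    (h0 : ∫ o, V o ∂P = 0) :
    CondCentered P (fun _ => ()) V (fun _ => ∫⁻ o, ENNReal.ofReal (V o ^ 2) ∂P) where
  measurable_left := measurable_const
  measurable_right := hV
  measurable_weight := measurable_const
  lintegral_sq h _ := by
    rw [lintegral_const_mul _ (hV.pow_const 2).ennreal_ofReal]
    simp
  integral_eq_zero h _ _ := by
    rw [integral_const_mul, h0, mul_zero]

/-- Chebyshev's inequality for normalised sums of i.i.d. centered variables. -/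
lemma measure_lt_abs_iid_sum_le {P : Measure E} [IsProbabilityMeasure P] {V : E → ℝ}
    (hV : Measurable V) (h0 : ∫ o, V o ∂P = 0) {n : ℕ} {ε : ℝ} (hε : 0 < ε) :
    (Measure.pi fun _ : Fin n => P) {ω | ε < |(√n)⁻¹ * ∑ i, V (ω i)|} ≤
      (∫⁻ o, ENNReal.ofReal (V o ^ 2) ∂P) / ENNReal.ofReal (ε ^ 2) := by
  -- With unit weights and the second moment as threshold, the exceptional event is empty.
  have h := (condCentered_unit hV h0).measure_lt_abs_sum_le (n := n) (a := fun _ _ => 1)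
    (fun _ => measurable_const) hε (∫⁻ o, ENNReal.ofReal (V o ^ 2) ∂P)
  simp only [one_mul] at h
  refine h.trans (le_of_eq ?_)
  have : ∀ u : Fin n → Unit, weightedMean (n := n) (fun _ : Unit => ∫⁻ o, ENNReal.ofReal (V o ^ 2) ∂P)
      (fun _ _ => 1) u ≤ ∫⁻ o, ENNReal.ofReal (V o ^ 2) ∂P := by
    intro u
    rw [weightedMean]
    simp only [one_pow, ENNReal.ofReal_one, one_mul, Finset.sum_const, Finset.card_univ,
      Fintype.card_fin, nsmul_eq_mul]
    rw [← mul_assoc]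
    exact mul_le_of_le_one_left' (ENNReal.inv_mul_le_one _)
  have hempty : {ω : Fin n → E | ∫⁻ o, ENNReal.ofReal (V o ^ 2) ∂P <
      weightedMean (n := n) (fun _ : Unit => ∫⁻ o, ENNReal.ofReal (V o ^ 2) ∂P)
      (fun _ _ => 1) (fun _ => ())} = ∅ := by
    ext ω
    simpa using this _
  rw [hempty, measure_empty, zero_add]

/-- Averages of i.i.d. centered variables with bounded second moments converge to zero in
probability. -/
lemma tendstoZeroInProb_mean {P : ℕ → Measure E} [∀ n, IsProbabilityMeasure (P n)]
    {V : ℕ → E → ℝ} (hV : ∀ n, Measurable (V n)) (h0 : ∀ n, ∫ o, V n o ∂(P n) = 0) {C : ℝ}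
    (hC : ∀ n, ∫⁻ o, ENNReal.ofReal (V n o ^ 2) ∂(P n) ≤ ENNReal.ofReal C) :
    TendstoZeroInProb (fun n => Measure.pi fun _ : Fin n => P n)
      (fun n ω => (1 / n : ℝ) * ∑ i, V n (ω i)) := by
  intro ε hε
  have hlim : Tendsto (fun n : ℕ => ENNReal.ofReal (C / ε ^ 2 / n)) atTop (𝓝 0) := by
    rw [← ENNReal.ofReal_zero]
    exact ENNReal.tendsto_ofReal (tendsto_const_div_atTop_nhds_zero_nat _)
  refine tendsto_of_tendsto_of_tendsto_of_le_of_le' tendsto_const_nhds hlim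
    (Eventually.of_forall fun _ => zero_le) ?_
  filter_upwards [eventually_gt_atTop 0] with n hn
  have hn' : (0 : ℝ) < n := by exact_mod_cast hn
  have hs : 0 < √(n : ℝ) := Real.sqrt_pos.2 hn'
  have hs2 : √(n : ℝ) ^ 2 = n := Real.sq_sqrt hn'.le
  have e : {ω : Fin n → E | ε < |(1 / n : ℝ) * ∑ i, V n (ω i)|} =
      {ω | √n * ε < |(√n)⁻¹ * ∑ i, V n (ω i)|} := by
    ext ω
    simp only [Set.mem_ofPred_eq]
    have : (1 / n : ℝ) * ∑ i, V n (ω i) = (√n)⁻¹ * ((√n)⁻¹ * ∑ i, V n (ω i)) := by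
      rw [← mul_assoc, ← mul_inv, ← sq, hs2, one_div]
    rw [this, abs_mul, abs_of_pos (inv_pos.2 hs), lt_inv_mul_iff₀ hs]
  rw [e]
  refine (measure_lt_abs_iid_sum_le (hV n) (h0 n) (mul_pos hs hε)).trans ?_
  refine (ENNReal.div_le_div_right (hC n) _).trans ?_
  rw [← ENNReal.ofReal_div_of_pos (by positivity)]
  refine ENNReal.ofReal_le_ofReal (le_of_eq ?_)
  rw [mul_pow, hs2]
  field_simp

/-- Markov's inequality for averages of nonnegative i.i.d. variables. -/
lemma measure_lt_mean_le {P : Measure E} [IsProbabilityMeasure P] {G : E → ℝ}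
    (hG : Measurable G) (hG0 : ∀ o, 0 ≤ G o) {n : ℕ} (hn : 0 < n) {ε : ℝ} (hε : 0 < ε) :
    (Measure.pi fun _ : Fin n => P) {ω | ε < (1 / n : ℝ) * ∑ i, G (ω i)} ≤
      (∫⁻ o, ENNReal.ofReal (G o) ∂P) / ENNReal.ofReal ε := by
  have hn' : (0 : ℝ) < n := by exact_mod_cast hn
  have hm : Measurable fun ω : Fin n → E => ENNReal.ofReal ((1 / n : ℝ) * ∑ i, G (ω i)) := by
    fun_prop
  have hmark := meas_ge_le_lintegral_div (μ := Measure.pi fun _ : Fin n => P)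
    hm.aemeasurable (ENNReal.ofReal_pos.2 hε).ne' ENNReal.ofReal_ne_top
  refine (measure_mono fun ω hω => ?_).trans (hmark.trans (ENNReal.div_le_div_right ?_ _))
  · exact ENNReal.ofReal_le_ofReal (le_of_lt hω)
  · have e : ∀ ω : Fin n → E, ENNReal.ofReal ((1 / n : ℝ) * ∑ i, G (ω i)) =
        (n : ℝ≥0∞)⁻¹ * ∑ i, ENNReal.ofReal (G (ω i)) := by
      intro ω
      rw [one_div, ENNReal.ofReal_mul (by positivity), ENNReal.ofReal_inv_of_pos hn',
        ENNReal.ofReal_natCast, ENNReal.ofReal_sum_of_nonneg fun i _ => hG0 _]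
    have hGi : ∀ i, Measurable fun ω : Fin n → E => ENNReal.ofReal (G (ω i)) := fun i => by fun_prop
    simp_rw [e]
    rw [lintegral_const_mul _ (Finset.measurable_sum _ fun i _ => hGi i),
      lintegral_finsetSum _ fun i _ => hGi i]
    have hi : ∀ i : Fin n, ∫⁻ ω, ENNReal.ofReal (G (ω i)) ∂(Measure.pi fun _ : Fin n => P) =
        ∫⁻ o, ENNReal.ofReal (G o) ∂P := fun i =>
      (measurePreserving_eval (fun _ : Fin n => P) i).lintegral_comp hG.ennreal_ofReal
    simp only [hi, Finset.sum_const, Finset.card_univ, Fintype.card_fin, nsmul_eq_mul]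
    rw [← mul_assoc, ENNReal.inv_mul_cancel (by exact_mod_cast hn.ne') (ENNReal.natCast_ne_top n),
      one_mul]

/-- Weak law of large numbers for squares in triangular arrays with i.i.d. rows, under uniform
integrability. -/
theorem tendstoZeroInProb_mean_sq_sub {P : ℕ → Measure E} [∀ n, IsProbabilityMeasure (P n)]
    {W : ℕ → E → ℝ} (hW : ∀ n, Measurable (W n))
    (h2 : ∀ n, Integrable (fun o => W n o ^ 2) (P n))
    (hUI : ∀ δ > 0, ∃ M : ℝ, 0 ≤ M ∧ ∀ n, ∫ o in {o | M < |W n o|}, W n o ^ 2 ∂(P n) ≤ δ) :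
    TendstoZeroInProb (fun n => Measure.pi fun _ : Fin n => P n)
      (fun n ω => (1 / n : ℝ) * ∑ i, W n (ω i) ^ 2 - ∫ o, W n o ^ 2 ∂(P n)) := by
  refine TendstoZeroInProb.of_le_add fun ε hε η hη => ?_
  -- The square is split at level M. The bounded part obeys Chebyshev; the tail has mean at most δ,
  -- so Markov bounds the probability that its average exceeds ε/3 by δ/(ε/3) ≤ η. Also δ ≤ ε/3
  -- absorbs the tail mean itself.
  obtain ⟨δ, hδ, hδε, hδη⟩ := exists_ofReal_div_le (show 0 < ε / 3 by positivity) hη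
  obtain ⟨M, hM0, hM⟩ := hUI δ hδ
  set A : ℕ → Set E := fun n => {o | M < |W n o|} with hA
  have hAm : ∀ n, MeasurableSet (A n) := fun n => by
    have := hW n
    exact measurableSet_lt measurable_const (by fun_prop)
  set G1 : ℕ → E → ℝ := fun n => (A n)ᶜ.indicator fun o => W n o ^ 2 with hG1
  set G2 : ℕ → E → ℝ := fun n => (A n).indicator fun o => W n o ^ 2 with hG2
  have hG12 : ∀ n o, W n o ^ 2 = G1 n o + G2 n o := fun n o => by
    have := congrFun (Set.indicator_self_add_compl (A n) fun o => W n o ^ 2) o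
    simp only [Pi.add_apply] at this
    rw [← this, add_comm]
  have hG1m : ∀ n, Measurable (G1 n) := fun n => ((hW n).pow_const 2).indicator (hAm n).compl
  have hG2m : ∀ n, Measurable (G2 n) := fun n => ((hW n).pow_const 2).indicator (hAm n)
  have hG2n : ∀ n o, 0 ≤ G2 n o := fun n o => Set.indicator_nonneg (fun _ _ => sq_nonneg _) _
  have hG1b : ∀ n o, |G1 n o| ≤ M ^ 2 := by
    intro n o
    by_cases ho : o ∈ A n
    · simp only [hG1, Set.indicator_of_notMem (Set.notMem_compl_iff.2 ho), abs_zero]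
      positivity
    · simp only [hG1, Set.indicator_of_mem (Set.mem_compl ho), abs_pow]
      exact pow_le_pow_left₀ (abs_nonneg _) (not_lt.1 ho) 2
  have hG1i : ∀ n, Integrable (G1 n) (P n) := fun n => (h2 n).indicator (hAm n).compl
  have hG2i : ∀ n, Integrable (G2 n) (P n) := fun n => (h2 n).indicator (hAm n)
  have hG2δ : ∀ n, ∫ o, G2 n o ∂(P n) ≤ δ := fun n => by
    rw [integral_indicator (hAm n)]
    exact hM n
  have hmean := tendstoZeroInProb_mean (P := P) (V := fun n o => G1 n o - ∫ o, G1 n o ∂(P n))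
    (fun n => (hG1m n).sub_const _)
    (fun n => by rw [integral_sub (hG1i n) (integrable_const _)]; simp)
    (C := (2 * M ^ 2) ^ 2) (fun n => by
      have hb : |∫ o, G1 n o ∂(P n)| ≤ M ^ 2 := by
        have := norm_integral_le_of_norm_le_const (μ := P n) (f := G1 n) (C := M ^ 2)
          (ae_of_all _ fun o => hG1b n o)
        simpa using this
      have : ∀ o, ENNReal.ofReal ((G1 n o - ∫ o, G1 n o ∂(P n)) ^ 2) ≤
          ENNReal.ofReal ((2 * M ^ 2) ^ 2) := fun o => by
        refine ENNReal.ofReal_le_ofReal (sq_le_sq' ?_ ?_)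
        · linarith [abs_le.1 (hG1b n o), abs_le.1 hb]
        · linarith [abs_le.1 (hG1b n o), abs_le.1 hb]
      refine (lintegral_mono this).trans ?_
      simp)
  refine ⟨_, hmean (ε / 3) (by positivity), ?_⟩
  filter_upwards [eventually_gt_atTop 0] with n hn
  have hn' : (0 : ℝ) < n := by exact_mod_cast hn
  have hsub : {ω : Fin n → E | ε < |(1 / n : ℝ) * ∑ i, W n (ω i) ^ 2 - ∫ o, W n o ^ 2 ∂(P n)|} ⊆
      {ω | ε / 3 < |(1 / n : ℝ) * ∑ i, (G1 n (ω i) - ∫ o, G1 n o ∂(P n))|} ∪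
      {ω | ε / 3 < (1 / n : ℝ) * ∑ i, G2 n (ω i)} := by
    intro ω hω
    by_contra hcon
    simp only [Set.mem_union, Set.mem_ofPred_eq, not_or, not_lt] at hcon hω
    obtain ⟨c1, c2⟩ := hcon
    have hnn : (0 : ℝ) ≤ (1 / n : ℝ) * ∑ i, G2 n (ω i) :=
      mul_nonneg (by positivity) (Finset.sum_nonneg fun i _ => hG2n _ _)
    have hi2 : 0 ≤ ∫ o, G2 n o ∂(P n) := integral_nonneg (hG2n n)
    have e : (1 / n : ℝ) * ∑ i, W n (ω i) ^ 2 - ∫ o, W n o ^ 2 ∂(P n) =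
        (1 / n : ℝ) * ∑ i, (G1 n (ω i) - ∫ o, G1 n o ∂(P n)) + (1 / n : ℝ) * ∑ i, G2 n (ω i) -
          ∫ o, G2 n o ∂(P n) := by
      simp_rw [hG12]
      rw [integral_add (hG1i n) (hG2i n), Finset.sum_add_distrib, Finset.sum_sub_distrib]
      simp only [Finset.sum_const, Finset.card_univ, Fintype.card_fin, nsmul_eq_mul]
      field_simp
      ring
    rw [e] at hω
    have := hG2δ n
    rw [abs_le] at c1
    refine absurd hω (not_lt.2 (abs_le.2 ⟨?_, ?_⟩)) <;> linarith
  refine (measure_mono hsub).trans ((measure_union_le _ _).trans (add_le_add le_rfl ?_))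
  refine (measure_lt_mean_le (hG2m n) (hG2n n) hn (by positivity)).trans ?_
  refine le_trans (ENNReal.div_le_div_right ?_ _) hδη
  rw [← ofReal_integral_eq_lintegral_ofReal (hG2i n) (ae_of_all _ (hG2n n))]
  exact ENNReal.ofReal_le_ofReal (hG2δ n)

end Sample

/-! ### Slutsky's theorem -/

/-- **Slutsky's theorem** for distribution functions along a sequence of probability spaces. -/
lemma tendsto_real_le_of_slutsky {Ω : ℕ → Type*} {mΩ : ∀ n, MeasurableSpace (Ω n)}
    {μ : ∀ n, Measure (Ω n)} [∀ n, IsProbabilityMeasure (μ n)] {T S r q : ∀ n, Ω n → ℝ}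
    {Φ : ℝ → ℝ} (hΦ : Continuous Φ)
    (hT : ∀ᶠ n in atTop, ∀ ω, 0 < q n ω → T n ω = (S n ω + r n ω) / q n ω)
    (hr : TendstoZeroInProb μ r) (hq : TendstoZeroInProb μ fun n ω => q n ω - 1)
    (hS : ∀ t, Tendsto (fun n => (μ n).real {ω | S n ω ≤ t}) atTop (𝓝 (Φ t))) (t : ℝ) :
    Tendsto (fun n => (μ n).real {ω | T n ω ≤ t}) atTop (𝓝 (Φ t)) := by
  rw [Metric.tendsto_nhds]
  intro κ hκ
  obtain ⟨δ, hδ, hΦδ⟩ := Metric.continuous_iff.1 hΦ t (κ / 4) (by positivity)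
  have hl := hΦδ (t - δ / 2) (by rw [Real.dist_eq, abs_lt]; constructor <;> linarith)
  have hu := hΦδ (t + δ / 2) (by rw [Real.dist_eq, abs_lt]; constructor <;> linarith)
  rw [Real.dist_eq, abs_lt] at hl hu
  -- The bound 1/2 keeps q positive when |q - 1| ≤ ρ; the other keeps the random threshold t q - r
  -- within |t|ρ + ρ ≤ δ/2 of t.
  set ρ : ℝ := min (1 / 2) (δ / 2 / (|t| + 1)) with hρ
  have hρ0 : 0 < ρ := by positivity
  have hρ1 : ρ < 1 := (min_le_left _ _).trans_lt (by norm_num)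
  have hρδ : |t| * ρ + ρ ≤ δ / 2 := by
    have h : ρ ≤ δ / 2 / (|t| + 1) := min_le_right _ _
    rw [le_div_iff₀ (by positivity)] at h
    linarith
  have hbad : Tendsto (fun n => (μ n).real {ω | ρ < |r n ω|} + (μ n).real {ω | ρ < |q n ω - 1|})
      atTop (𝓝 0) := by
    have h1 := (ENNReal.tendsto_toReal ENNReal.zero_ne_top).comp (hr ρ hρ0)
    have h2 := (ENNReal.tendsto_toReal ENNReal.zero_ne_top).comp (hq ρ hρ0)
    simpa [Measure.real] using h1.add h2
  filter_upwards [hT, hbad.eventually (gt_mem_nhds (show (0 : ℝ) < κ / 4 by positivity)),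
    (hS (t - δ / 2)).eventually
      (lt_mem_nhds (show Φ (t - δ / 2) - κ / 4 < Φ (t - δ / 2) by linarith)),
    (hS (t + δ / 2)).eventually
      (gt_mem_nhds (show Φ (t + δ / 2) < Φ (t + δ / 2) + κ / 4 by linarith))] with n hTn hb h1 h2
  have hbound : ∀ ω, |r n ω| ≤ ρ → |q n ω - 1| ≤ ρ →
      0 < q n ω ∧ |(t * q n ω - r n ω) - t| ≤ δ / 2 := by
    intro ω hrω hqω
    refine ⟨by linarith [(abs_le.1 hqω).1], ?_⟩
    have e : (t * q n ω - r n ω) - t = t * (q n ω - 1) - r n ω := by ring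
    rw [e]
    refine (abs_sub _ _).trans ?_
    rw [abs_mul]
    have := mul_le_mul_of_nonneg_left hqω (abs_nonneg t)
    linarith
  have hiff : ∀ ω, 0 < q n ω → (T n ω ≤ t ↔ S n ω ≤ t * q n ω - r n ω) := by
    intro ω hω
    rw [hTn ω hω, div_le_iff₀ hω, le_sub_iff_add_le]
  have hsub1 : {ω | T n ω ≤ t} ⊆
      {ω | S n ω ≤ t + δ / 2} ∪ ({ω | ρ < |r n ω|} ∪ {ω | ρ < |q n ω - 1|}) := by
    intro ω hω
    by_cases hrω : |r n ω| ≤ ρ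
    · by_cases hqω : |q n ω - 1| ≤ ρ
      · left
        obtain ⟨h0, h⟩ := hbound ω hrω hqω
        exact ((hiff ω h0).1 hω).trans (by linarith [(abs_le.1 h).2])
      · exact Or.inr (Or.inr (not_le.1 hqω))
    · exact Or.inr (Or.inl (not_le.1 hrω))
  have hsub2 : {ω | S n ω ≤ t - δ / 2} ⊆
      {ω | T n ω ≤ t} ∪ ({ω | ρ < |r n ω|} ∪ {ω | ρ < |q n ω - 1|}) := by
    intro ω hω
    by_cases hrω : |r n ω| ≤ ρ
    · by_cases hqω : |q n ω - 1| ≤ ρ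
      · left
        obtain ⟨h0, h⟩ := hbound ω hrω hqω
        exact (hiff ω h0).2 (le_trans hω (by linarith [(abs_le.1 h).1]))
      · exact Or.inr (Or.inr (not_le.1 hqω))
    · exact Or.inr (Or.inl (not_le.1 hrω))
  have m1 := (measureReal_mono hsub1 (measure_ne_top (μ n) _)).trans
    ((measureReal_union_le _ _).trans (add_le_add le_rfl (measureReal_union_le _ _)))
  have m2 := (measureReal_mono hsub2 (measure_ne_top (μ n) _)).trans
    ((measureReal_union_le _ _).trans (add_le_add le_rfl (measureReal_union_le _ _)))
  rw [Real.dist_eq, abs_lt]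
  constructor <;> linarith

lemma exists_pos_le_of_continuous {F : ℝ → ℝ} (hF : Continuous F) (h0 : F 0 = 0) {ε : ℝ}
    (hε : 0 < ε) : ∃ δ : ℝ, 0 < δ ∧ δ ≤ 1 ∧ F δ ≤ ε := by
  obtain ⟨δ, hδ, h⟩ := Metric.continuous_iff.1 hF 0 ε hε
  refine ⟨min 1 (δ / 2), by positivity, min_le_left _ _, ?_⟩
  have hlt : min 1 (δ / 2) < δ := (min_le_right _ _).trans_lt (by linarith)
  have := h (min 1 (δ / 2)) (by
    rw [dist_zero_right, Real.norm_of_nonneg (by positivity)]; exact hlt)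
  rw [h0, dist_zero_right] at this
  exact (le_abs_self _).trans this.le

/-! ### Deterministic bounds for products of residuals -/

section Decomposition

variable {n : ℕ} (a b e x : Fin n → ℝ)

/-- The difference is ab + ax + be, and (p + q + r)² ≤ 3(p² + q² + r²). The sum of (a_i b_i)² is the
diagonal part of (Σ a_i²)(Σ b_i²); rewriting the latter with two averages leaves the factor n. -/
lemma mean_sq_mul_sub_mul_le (hn : 0 < n) :
    (1 / n : ℝ) * ∑ i, ((e i + a i) * (x i + b i) - e i * x i) ^ 2 ≤
      3 * (n * (((1 / n : ℝ) * ∑ i, a i ^ 2) * ((1 / n : ℝ) * ∑ i, b i ^ 2)) +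
        (1 / n : ℝ) * ∑ i, (a i * x i) ^ 2 + (1 / n : ℝ) * ∑ i, (b i * e i) ^ 2) := by
  have hn' : (0 : ℝ) < n := by exact_mod_cast hn
  have h1 : ∑ i, (a i * b i) ^ 2 ≤ (∑ i, a i ^ 2) * ∑ i, b i ^ 2 := by
    rw [Finset.sum_mul]
    refine Finset.sum_le_sum fun i _ => ?_
    rw [mul_pow]
    exact mul_le_mul_of_nonneg_left
      (Finset.single_le_sum (f := fun i => b i ^ 2) (fun _ _ => sq_nonneg _) (Finset.mem_univ i))
      (sq_nonneg _)
  have h2 : ∑ i, ((e i + a i) * (x i + b i) - e i * x i) ^ 2 ≤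
      3 * (∑ i, (a i * b i) ^ 2 + ∑ i, (a i * x i) ^ 2 + ∑ i, (b i * e i) ^ 2) := by
    rw [← Finset.sum_add_distrib, ← Finset.sum_add_distrib, Finset.mul_sum]
    refine Finset.sum_le_sum fun i _ => ?_
    nlinarith [sq_nonneg (a i * b i - a i * x i), sq_nonneg (a i * b i - b i * e i),
      sq_nonneg (a i * x i - b i * e i)]
  have e1 : (n : ℝ) * (((1 / n : ℝ) * ∑ i, a i ^ 2) * ((1 / n : ℝ) * ∑ i, b i ^ 2)) =
      (1 / n : ℝ) * ((∑ i, a i ^ 2) * ∑ i, b i ^ 2) := by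
    field_simp
  rw [e1, ← mul_add, ← mul_add, mul_left_comm]
  refine mul_le_mul_of_nonneg_left (h2.trans ?_) (by positivity)
  linarith

/-- Cauchy–Schwarz is spent on ab only. The cross sums keep their signs, because their smallness
comes from cancellation. -/
lemma abs_inv_sqrt_mul_sum_sub_le (hn : 0 < n) :
    |(√n)⁻¹ * ∑ i, ((e i + a i) * (x i + b i) - e i * x i)| ≤
      √(n * (((1 / n : ℝ) * ∑ i, a i ^ 2) * ((1 / n : ℝ) * ∑ i, b i ^ 2))) +
        |(√n)⁻¹ * ∑ i, a i * x i| + |(√n)⁻¹ * ∑ i, b i * e i| := by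
  have hn' : (0 : ℝ) < n := by exact_mod_cast hn
  have hs2 : √(n : ℝ) ^ 2 = n := Real.sq_sqrt hn'.le
  have e1 : (√n)⁻¹ * ∑ i, ((e i + a i) * (x i + b i) - e i * x i) =
      (√n)⁻¹ * (∑ i, a i * b i) + (√n)⁻¹ * (∑ i, a i * x i) + (√n)⁻¹ * ∑ i, b i * e i := by
    rw [← mul_add, ← mul_add, ← Finset.sum_add_distrib, ← Finset.sum_add_distrib]
    congr 1
    exact Finset.sum_congr rfl fun i _ => by ring
  rw [e1]
  refine (abs_add_three _ _ _).trans ?_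
  gcongr
  rw [← Real.sqrt_sq_eq_abs]
  refine Real.sqrt_le_sqrt ?_
  have e2 : (n : ℝ) * (((1 / n : ℝ) * ∑ i, a i ^ 2) * ((1 / n : ℝ) * ∑ i, b i ^ 2)) =
      (n : ℝ)⁻¹ * ((∑ i, a i ^ 2) * ∑ i, b i ^ 2) := by
    field_simp
  rw [e2, mul_pow, inv_pow, hs2]
  exact mul_le_mul_of_nonneg_left (Finset.sum_mul_sq_le_sq_mul_sq _ _ _) (by positivity)

/-- Perturbation bound for empirical second moments. -/
lemma abs_mean_sq_sub_mean_sq_le (R W : Fin n → ℝ) :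
    |(1 / n : ℝ) * ∑ i, R i ^ 2 - (1 / n : ℝ) * ∑ i, W i ^ 2| ≤
      (1 / n : ℝ) * ∑ i, (R i - W i) ^ 2 +
        2 * √(((1 / n : ℝ) * ∑ i, (R i - W i) ^ 2) * ((1 / n : ℝ) * ∑ i, W i ^ 2)) := by
  have e1 : (1 / n : ℝ) * ∑ i, R i ^ 2 - (1 / n : ℝ) * ∑ i, W i ^ 2 =
      (1 / n : ℝ) * ∑ i, (R i - W i) ^ 2 + 2 * ((1 / n : ℝ) * ∑ i, (R i - W i) * W i) := by
    rw [← mul_sub, mul_left_comm, ← mul_add, Finset.mul_sum, ← Finset.sum_sub_distrib,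
      ← Finset.sum_add_distrib]
    congr 1
    exact Finset.sum_congr rfl fun i _ => by ring
  rw [e1]
  refine (abs_add_le _ _).trans (add_le_add (le_of_eq (abs_of_nonneg ?_)) ?_)
  · exact mul_nonneg (by positivity) (Finset.sum_nonneg fun _ _ => sq_nonneg _)
  · rw [abs_mul, abs_two]
    refine mul_le_mul_of_nonneg_left ?_ (by norm_num)
    rw [← Real.sqrt_sq_eq_abs]
    refine Real.sqrt_le_sqrt ?_
    rw [mul_pow, mul_mul_mul_comm, ← sq]
    exact mul_le_mul_of_nonneg_left (Finset.sum_mul_sq_le_sq_mul_sq _ _ _) (by positivity)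

end Decomposition

/-! ### Asymptotic normality along a sequence of laws -/

/-- The product of the two population residuals. -/
noncomputable def noiseProd (P : ProbabilityMeasure (Obs d)) (o : Obs d) : ℝ :=
  noise coordX P o * noise coordY P o

lemma measurable_noiseProd (P : ProbabilityMeasure (Obs d)) : Measurable (noiseProd P) :=
  (measurable_noise measurable_coordX P).mul (measurable_noise measurable_coordY P)

/-- The cross terms between the prediction error of one regression and the noise of the other
response vanish in probability. -/
lemma tendstoZeroInProb_cross {W W' : Obs d → ℝ} {h : Regression d}
    (hh : h.IsMeasurable) {P : ℕ → ProbabilityMeasure (Obs d)}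
    (hcc : ∀ n, CondCentered (P n : Measure (Obs d)) (fun o => (coordZ o, W' o)) (noise W (P n))
      (fun u => condVariance W (P n) u.1))
    (hB : ∀ ε : ℝ, 0 < ε → Tendsto (fun n => sampleLaw (P n) n
      {ω | ENNReal.ofReal ε < weightedPredErr W' W h (P n) n ω}) atTop (𝓝 0)) :
    TendstoZeroInProb (fun n => sampleLaw (P n) n) (fun n ω => (√n)⁻¹ *
      ∑ i, (condMean W' (P n) (coordZ (ω i)) - fitted W' h ω i) * noise W (P n) (ω i)) ∧
    TendstoZeroInProb (fun n => sampleLaw (P n) n) (fun n ω => (1 / n : ℝ) *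
      ∑ i, ((condMean W' (P n) (coordZ (ω i)) - fitted W' h ω i) * noise W (P n) (ω i)) ^ 2) := by
  -- The prediction error for W' is a function of the pairs (z_j, w'_j) alone, exactly the variables
  -- given which the noise of W is centered.
  let a : ∀ n : ℕ, Fin n → (Fin n → (Fin d → ℝ) × ℝ) → ℝ := fun n i u =>
    condMean W' (P n) (u i).1 - h n (fun j => (u j).2) (fun j => (u j).1) (u i).1
  have ha : ∀ n i, Measurable (a n i) := by
    intro n i
    have h1 := measurable_condMean W' (P n)
    have h2 : Measurable fun u : Fin n → (Fin d → ℝ) × ℝ =>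
        h n (fun j => (u j).2) (fun j => (u j).1) (u i).1 :=
      (hh n i).comp (g := fun q : (Fin n → ℝ) × (Fin n → Fin d → ℝ) => h n q.1 q.2 (q.2 i))
        (f := fun u : Fin n → (Fin d → ℝ) × ℝ => (fun j => (u j).2, fun j => (u j).1))
        (by fun_prop)
    exact Measurable.sub (by fun_prop) h2
  have hw : ∀ n (ω : Fin n → Obs d), weightedMean (fun u : (Fin d → ℝ) × ℝ =>
      condVariance W (P n) u.1) (a n) (fun j => (coordZ (ω j), W' (ω j))) =
      weightedPredErr W' W h (P n) n ω := fun n ω => rfl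
  constructor
  · refine TendstoZeroInProb.of_le_add fun ε hε η hη => ?_
    obtain ⟨δ, hδ, -, hδη⟩ := exists_ofReal_div_le (show 0 < ε ^ 2 by positivity) hη
    refine ⟨_, hB δ hδ, Eventually.of_forall fun n => ?_⟩
    have := (hcc n).measure_lt_abs_sum_le (ha n) hε (ENNReal.ofReal δ)
    simp only [hw] at this
    exact this.trans (add_le_add le_rfl hδη)
  · refine TendstoZeroInProb.of_le_add fun ε hε η hη => ?_
    obtain ⟨δ, hδ, -, hδη⟩ := exists_ofReal_div_le hε hη
    refine ⟨_, hB δ hδ, Eventually.of_forall fun n => ?_⟩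
    have := (hcc n).measure_lt_mean_sq_le (ha n) hε (ENNReal.ofReal δ)
    simp only [hw] at this
    refine le_trans (le_of_eq ?_) (this.trans (add_le_add le_rfl hδη))
    congr 1
    ext ω
    simp only [Set.mem_ofPred_eq]
    rw [abs_of_nonneg]
    · rfl
    · exact mul_nonneg (by positivity) (Finset.sum_nonneg fun _ _ => sq_nonneg _)

/-- Under the null hypothesis, each noise is centered given `Z` and the other response. -/
lemma condCentered_of_mem_nullClass {P : ProbabilityMeasure (Obs d)} (hP : P ∈ nullClass d)
    (hX : HasCondMean coordX P) (hY : HasCondMean coordY P) :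
    CondCentered (P : Measure (Obs d)) (fun o => (coordZ o, coordY o)) (noise coordX P)
      (fun u => condVariance coordX P u.1) ∧
    CondCentered (P : Measure (Obs d)) (fun o => (coordZ o, coordX o)) (noise coordY P)
      (fun u => condVariance coordY P u.1) :=
  ⟨condCentered_noise measurable_coordX measurable_coordY hP.2.symm hX,
    condCentered_noise measurable_coordY measurable_coordX hP.2 hY⟩

lemma integrable_noiseProd {P : ProbabilityMeasure (Obs d)}
    (h2 : Integrable (fun o => noiseProd P o ^ 2) (P : Measure (Obs d))) :
    Integrable (noiseProd P) (P : Measure (Obs d)) :=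
  ((memLp_two_iff_integrable_sq (measurable_noiseProd P).aestronglyMeasurable).2 h2).integrable
    one_le_two

/-- ε is a function of (Z, X), hence an admissible test function against ξ. -/
lemma integral_noiseProd_eq_zero {P : ProbabilityMeasure (Obs d)}
    (hcc : CondCentered (P : Measure (Obs d)) (fun o => (coordZ o, coordX o)) (noise coordY P)
      (fun u => condVariance coordY P u.1))
    (h1 : Integrable (noiseProd P) (P : Measure (Obs d))) :
    ∫ o, noiseProd P o ∂(P : Measure (Obs d)) = 0 := by
  have hm := measurable_condMean coordX P
  exact hcc.integral_eq_zero (fun u => u.2 - condMean coordX P u.1) (by fun_prop) h1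

/-- The numerator remainder of the statistic. -/
noncomputable def residRemainder (fhat ghat : Regression d) (P : ProbabilityMeasure (Obs d)) (n : ℕ)
    (ω : Fin n → Obs d) : ℝ :=
  (√n)⁻¹ * ∑ i, (residProd fhat ghat ω i - noiseProd P (ω i))

/-- The mean squared difference between the products of residuals and of noises. -/
noncomputable def residMeanSq (fhat ghat : Regression d) (P : ProbabilityMeasure (Obs d)) (n : ℕ)
    (ω : Fin n → Obs d) : ℝ :=
  (1 / n : ℝ) * ∑ i, (residProd fhat ghat ω i - noiseProd P (ω i)) ^ 2

/-- The empirical variance of the products of residuals. -/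
noncomputable def residVar (fhat ghat : Regression d) (n : ℕ) (ω : Fin n → Obs d) : ℝ :=
  (1 / n : ℝ) * ∑ i, residProd fhat ghat ω i ^ 2 - ((1 / n : ℝ) * ∑ i, residProd fhat ghat ω i) ^ 2

lemma residProd_eq (fhat ghat : Regression d) (P : ProbabilityMeasure (Obs d)) {n : ℕ}
    (ω : Fin n → Obs d) (i : Fin n) :
    residProd fhat ghat ω i =
      (noise coordX P (ω i) + (condMean coordX P (coordZ (ω i)) - fitted coordX fhat ω i)) *
      (noise coordY P (ω i) + (condMean coordY P (coordZ (ω i)) - fitted coordY ghat ω i)) := by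
  unfold residProd noise
  ring

/-- The conditions of the theorem along a sequence of laws, in the form used in the proof. -/
structure SeqConditions (fhat ghat : Regression d) (P : ℕ → ProbabilityMeasure (Obs d)) : Prop where
  fhat_measurable : fhat.IsMeasurable
  ghat_measurable : ghat.IsMeasurable
  condCentered_X : ∀ n, CondCentered (P n : Measure (Obs d)) (fun o => (coordZ o, coordY o))
    (noise coordX (P n)) (fun u => condVariance coordX (P n) u.1)
  condCentered_Y : ∀ n, CondCentered (P n : Measure (Obs d)) (fun o => (coordZ o, coordX o))
    (noise coordY (P n)) (fun u => condVariance coordY (P n) u.1)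
  predErr : TendstoZeroInProb (fun n => sampleLaw (P n) n)
    (fun n ω => n * (predErr coordX fhat (P n) n ω * predErr coordY ghat (P n) n ω))
  weighted_X : ∀ ε : ℝ, 0 < ε → Tendsto (fun n => sampleLaw (P n) n
    {ω | ENNReal.ofReal ε < weightedPredErr coordX coordY fhat (P n) n ω}) atTop (𝓝 0)
  weighted_Y : ∀ ε : ℝ, 0 < ε → Tendsto (fun n => sampleLaw (P n) n
    {ω | ENNReal.ofReal ε < weightedPredErr coordY coordX ghat (P n) n ω}) atTop (𝓝 0)
  integrable_sq : ∀ n, Integrable (fun o => noiseProd (P n) o ^ 2) (P n : Measure (Obs d))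
  uniformIntegrable : ∀ δ > 0, ∃ M : ℝ, 0 ≤ M ∧ ∀ n,
    ∫ o in {o | M < |noiseProd (P n) o|}, noiseProd (P n) o ^ 2 ∂(P n : Measure (Obs d)) ≤ δ

namespace SeqConditions

variable {fhat ghat : Regression d} {P : ℕ → ProbabilityMeasure (Obs d)}

/-- Uniform integrability bounds second moments: a square is at most M² plus its tail part. -/
lemma exists_variance_le (h : SeqConditions fhat ghat P) :
    ∃ C : ℝ, 0 ≤ C ∧ ∀ n, ∫ o, noiseProd (P n) o ^ 2 ∂(P n : Measure (Obs d)) ≤ C := by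
  obtain ⟨M, hM0, hM⟩ := h.uniformIntegrable 1 one_pos
  refine ⟨M ^ 2 + 1, by positivity, fun n => ?_⟩
  have hA : MeasurableSet {o | M < |noiseProd (P n) o|} := by
    have := measurable_noiseProd (P n)
    exact measurableSet_lt measurable_const (by fun_prop)
  have hi := (h.integrable_sq n).indicator hA
  have hle : ∀ o, noiseProd (P n) o ^ 2 ≤ M ^ 2 +
      {o | M < |noiseProd (P n) o|}.indicator (fun o => noiseProd (P n) o ^ 2) o := by
    intro o
    by_cases ho : o ∈ {o | M < |noiseProd (P n) o|}
    · rw [Set.indicator_of_mem ho]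
      exact le_add_of_nonneg_left (by positivity)
    · rw [Set.indicator_of_notMem ho, add_zero, ← sq_abs]
      exact pow_le_pow_left₀ (abs_nonneg _) (not_lt.1 ho) 2
  refine (integral_mono (h.integrable_sq n) ((integrable_const _).add hi) hle).trans ?_
  rw [integral_add' (integrable_const _) hi, integral_indicator hA]
  simpa using hM n

lemma residRemainder_tendsto (h : SeqConditions fhat ghat P) :
    TendstoZeroInProb (fun n => sampleLaw (P n) n)
      (fun n ω => residRemainder fhat ghat (P n) n ω) := by
  have hX := (tendstoZeroInProb_cross h.fhat_measurable h.condCentered_Y h.weighted_X).1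
  have hY := (tendstoZeroInProb_cross h.ghat_measurable h.condCentered_X h.weighted_Y).1
  refine TendstoZeroInProb.of_finite (ι := Fin 3) (V := ![_, _, _])
    (fun k => by fin_cases k; exacts [h.predErr, hX, hY]) fun ε hε => ?_
  -- The root comes from n A_f A_g via Cauchy–Schwarz, the linear terms from the two cross sums.
  obtain ⟨δ, hδ, -, hle⟩ := exists_pos_le_of_continuous (F := fun δ => √δ + δ + δ)
    (by fun_prop) (by simp) hε
  refine ⟨δ, hδ, (eventually_gt_atTop 0).mono fun n hn ω hω => ?_⟩
  have b1 : |(n : ℝ) * (GCM.predErr coordX fhat (P n) n ω * GCM.predErr coordY ghat (P n) n ω)| ≤ δ :=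
    hω 0
  have b2 := hω 1
  have b3 := hω 2
  refine le_trans ?_ hle
  unfold residRemainder
  simp only [residProd_eq fhat ghat (P n), noiseProd]
  refine (abs_inv_sqrt_mul_sum_sub_le _ _ _ _ hn).trans ?_
  exact add_le_add (add_le_add (Real.sqrt_le_sqrt ((le_abs_self _).trans b1)) b2) b3

lemma residMeanSq_tendsto (h : SeqConditions fhat ghat P) :
    TendstoZeroInProb (fun n => sampleLaw (P n) n)
      (fun n ω => residMeanSq fhat ghat (P n) n ω) := by
  have hX := (tendstoZeroInProb_cross h.fhat_measurable h.condCentered_Y h.weighted_X).2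
  have hY := (tendstoZeroInProb_cross h.ghat_measurable h.condCentered_X h.weighted_Y).2
  refine TendstoZeroInProb.of_finite (ι := Fin 3) (V := ![_, _, _])
    (fun k => by fin_cases k; exacts [h.predErr, hX, hY]) fun ε hε => ?_
  -- Three terms, with the factor 3 of the squared expansion.
  refine ⟨ε / 9, by positivity, (eventually_gt_atTop 0).mono fun n hn ω hω => ?_⟩
  have b1 : |(n : ℝ) * (GCM.predErr coordX fhat (P n) n ω * GCM.predErr coordY ghat (P n) n ω)| ≤
    ε / 9 := hω 0
  have b2 := (le_abs_self _).trans (hω 1)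
  have b3 := (le_abs_self _).trans (hω 2)
  rw [residMeanSq, abs_of_nonneg (mul_nonneg (by positivity)
    (Finset.sum_nonneg fun _ _ => sq_nonneg _))]
  simp only [residProd_eq fhat ghat (P n), noiseProd]
  refine (mean_sq_mul_sub_mul_le _ _ _ _ hn).trans ?_
  have := add_le_add (add_le_add ((le_abs_self _).trans b1) b2) b3
  refine (mul_le_mul_of_nonneg_left this (by norm_num)).trans (le_of_eq (by ring))

lemma residVar_tendsto (h : SeqConditions fhat ghat P) :
    TendstoZeroInProb (fun n => sampleLaw (P n) n) (fun n ω => residVar fhat ghat n ω -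
      ∫ o, noiseProd (P n) o ^ 2 ∂(P n : Measure (Obs d))) := by
  obtain ⟨C, hC0, hC⟩ := h.exists_variance_le
  have hW : ∀ n, Measurable (noiseProd (P n)) := fun n => measurable_noiseProd (P n)
  have h1 : ∀ n, Integrable (noiseProd (P n)) (P n : Measure (Obs d)) := fun n =>
    integrable_noiseProd (h.integrable_sq n)
  have hlln := tendstoZeroInProb_mean_sq_sub (P := fun n => (P n : Measure (Obs d))) hW
    h.integrable_sq h.uniformIntegrable
  have hmean := tendstoZeroInProb_mean (P := fun n => (P n : Measure (Obs d))) hW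
    (fun n => integral_noiseProd_eq_zero (h.condCentered_Y n) (h1 n)) (C := C) (fun n => by
      rw [← ofReal_integral_eq_lintegral_ofReal (h.integrable_sq n)
        (ae_of_all _ fun _ => sq_nonneg _)]
      exact ENNReal.ofReal_le_ofReal (hC n))
  refine TendstoZeroInProb.of_finite (ι := Fin 4) (V := ![_, _, _, _])
    (fun k => by
      fin_cases k
      exacts [h.residMeanSq_tendsto, hlln, hmean, h.residRemainder_tendsto]) fun ε hε => ?_
  -- The summands bound, in order: replacing residual products by noise products in the second
  -- moment, the law of large numbers error, and the squared sample mean. C + 1 bounds the empirical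
  -- second moment of the noise because δ ≤ 1.
  obtain ⟨δ, hδ, hδ1, hle⟩ := exists_pos_le_of_continuous
    (F := fun δ => (δ + 2 * √(δ * (C + 1))) + δ + (2 * δ) ^ 2) (by fun_prop) (by simp) hε
  refine ⟨δ, hδ, (eventually_gt_atTop 0).mono fun n hn ω hω => ?_⟩
  have hn' : (1 : ℝ) ≤ n := by exact_mod_cast hn
  have hn0 : (0 : ℝ) < n := by linarith
  have b1 : |residMeanSq fhat ghat (P n) n ω| ≤ δ := hω 0
  have b2 : |(1 / n : ℝ) * ∑ i, noiseProd (P n) (ω i) ^ 2 -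
    ∫ o, noiseProd (P n) o ^ 2 ∂(P n : Measure (Obs d))| ≤ δ := hω 1
  have b3 : |(1 / n : ℝ) * ∑ i, noiseProd (P n) (ω i)| ≤ δ := hω 2
  have b4 : |residRemainder fhat ghat (P n) n ω| ≤ δ := hω 3
  refine le_trans ?_ hle
  have hsq := abs_mean_sq_sub_mean_sq_le (n := n) (fun i => residProd fhat ghat ω i)
    (fun i => noiseProd (P n) (ω i))
  have hm2 : (1 / n : ℝ) * ∑ i, noiseProd (P n) (ω i) ^ 2 ≤ C + 1 := by
    have := hC n
    linarith [(abs_le.1 b2).2]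
  have hD0 : (1 / n : ℝ) * ∑ i, (residProd fhat ghat ω i - noiseProd (P n) (ω i)) ^ 2 ≤ δ :=
    (le_abs_self _).trans b1
  have hsq' : |(1 / n : ℝ) * ∑ i, residProd fhat ghat ω i ^ 2 -
      (1 / n : ℝ) * ∑ i, noiseProd (P n) (ω i) ^ 2| ≤ δ + 2 * √(δ * (C + 1)) := by
    refine hsq.trans (add_le_add hD0 ?_)
    refine mul_le_mul_of_nonneg_left (Real.sqrt_le_sqrt ?_) (by norm_num)
    exact mul_le_mul hD0 hm2 (mul_nonneg (by positivity)
      (Finset.sum_nonneg fun _ _ => sq_nonneg _)) hδ.le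
  have hm1 : |(1 / n : ℝ) * ∑ i, residProd fhat ghat ω i| ≤ 2 * δ := by
    have e : (1 / n : ℝ) * ∑ i, residProd fhat ghat ω i =
        (1 / n : ℝ) * ∑ i, noiseProd (P n) (ω i) +
          (√n)⁻¹ * residRemainder fhat ghat (P n) n ω := by
      rw [residRemainder, ← mul_assoc, ← mul_inv, Real.mul_self_sqrt hn0.le, one_div, ← mul_add,
        ← Finset.sum_add_distrib]
      simp
    rw [e, two_mul]
    refine (abs_add_le _ _).trans (add_le_add b3 ?_)
    rw [abs_mul, abs_of_nonneg (by positivity)]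
    have : (√(n : ℝ))⁻¹ ≤ 1 := inv_le_one_of_one_le₀ (Real.one_le_sqrt.2 hn')
    exact (mul_le_of_le_one_left (abs_nonneg _) this).trans b4
  have hm1' : ((1 / n : ℝ) * ∑ i, residProd fhat ghat ω i) ^ 2 ≤ (2 * δ) ^ 2 := by
    rw [← sq_abs]
    exact pow_le_pow_left₀ (abs_nonneg _) hm1 2
  have hm1'' := sq_nonneg ((1 / n : ℝ) * ∑ i, residProd fhat ghat ω i)
  unfold residVar
  rw [abs_le] at hsq' b2 ⊢
  constructor <;> linarith

/-- Asymptotic normality of the statistic along a sequence of laws. -/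
theorem tendsto_normalDist (h : SeqConditions fhat ghat P) {c : ℝ} (hc : 0 < c)
    (hvar : ∀ n, c ≤ ∫ o, noiseProd (P n) o ^ 2 ∂(P n : Measure (Obs d))) :
    Tendsto (fun n => normalDist fhat ghat (P n) n) atTop (𝓝 0) := by
  have hW : ∀ n, Measurable (noiseProd (P n)) := fun n => measurable_noiseProd (P n)
  have h1 : ∀ n, Integrable (noiseProd (P n)) (P n : Measure (Obs d)) := fun n =>
    integrable_noiseProd (h.integrable_sq n)
  set σ : ℕ → ℝ := fun n => √(∫ o, noiseProd (P n) o ^ 2 ∂(P n : Measure (Obs d))) with hσ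
  have hσpos : ∀ n, 0 < σ n := fun n => Real.sqrt_pos.2 (hc.trans_le (hvar n))
  have hσsq : ∀ n, σ n ^ 2 = ∫ o, noiseProd (P n) o ^ 2 ∂(P n : Measure (Obs d)) := fun n =>
    Real.sq_sqrt (hc.le.trans (hvar n))
  have hσc : ∀ n, √c ≤ σ n := fun n => Real.sqrt_le_sqrt (hvar n)
  have hcs : 0 < √c := Real.sqrt_pos.2 hc
  have hclt := tendsto_pi_real_normalized_sum_le (fun n => (P n : Measure (Obs d))) hW h1
    h.integrable_sq (fun n => integral_noiseProd_eq_zero (h.condCentered_Y n) (h1 n)) hcs hσpos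
    hσsq hσc h.uniformIntegrable
  have hr : TendstoZeroInProb (fun n => sampleLaw (P n) n)
      (fun n ω => residRemainder fhat ghat (P n) n ω / σ n) := by
    refine TendstoZeroInProb.of_finite (ι := Unit) (fun _ => h.residRemainder_tendsto)
      fun ε hε => ⟨ε * √c, by positivity, Eventually.of_forall fun n ω hω => ?_⟩
    rw [abs_div, abs_of_pos (hσpos n), div_le_iff₀ (hσpos n)]
    exact (hω ()).trans (mul_le_mul_of_nonneg_left (hσc n) hε.le)
  have hq : TendstoZeroInProb (fun n => sampleLaw (P n) n)
      (fun n ω => √(residVar fhat ghat n ω) / σ n - 1) := by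
    refine TendstoZeroInProb.of_finite (ι := Unit) (fun _ => h.residVar_tendsto)
      fun ε hε => ⟨ε * c, by positivity, Eventually.of_forall fun n ω hω => ?_⟩
    have hb := hω ()
    rw [← hσsq] at hb
    have hs := hσpos n
    have hcσ : c ≤ σ n ^ 2 := (hσsq n) ▸ hvar n
    rw [div_sub_one hs.ne', abs_div, abs_of_pos hs, div_le_iff₀ hs]
    refine le_of_mul_le_mul_right ?_ hs
    -- From Q - σ² = (√Q - σ)(√Q + σ) and √Q + σ ≥ σ; for Q ≤ 0 the root is 0 by convention and the
    -- bound is still true.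
    have hkey : |√(residVar fhat ghat n ω) - σ n| * σ n ≤ |residVar fhat ghat n ω - σ n ^ 2| := by
      have h0 := Real.sqrt_nonneg (residVar fhat ghat n ω)
      rcases le_total 0 (residVar fhat ghat n ω) with hQ | hQ
      · have e : residVar fhat ghat n ω - σ n ^ 2 =
            (√(residVar fhat ghat n ω) - σ n) * (√(residVar fhat ghat n ω) + σ n) := by
          nlinarith [Real.sq_sqrt hQ]
        rw [e, abs_mul]
        refine mul_le_mul_of_nonneg_left ?_ (abs_nonneg _)
        rw [abs_of_nonneg (by positivity)]
        linarith
      · rw [Real.sqrt_eq_zero_of_nonpos hQ, zero_sub, abs_neg, abs_of_pos hs,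
          abs_of_nonpos (by nlinarith)]
        nlinarith
    nlinarith
  have hT : ∀ᶠ n : ℕ in atTop, ∀ ω : Fin n → Obs d, 0 < √(residVar fhat ghat n ω) / σ n →
      gcmStat fhat ghat ω = ((√n)⁻¹ / σ n * (∑ i, noiseProd (P n) (ω i)) +
        residRemainder fhat ghat (P n) n ω / σ n) / (√(residVar fhat ghat n ω) / σ n) := by
    filter_upwards [eventually_gt_atTop 0] with n hn ω _
    have hn0 : (0 : ℝ) < n := by exact_mod_cast hn
    have e1 : (√n)⁻¹ / σ n * (∑ i, noiseProd (P n) (ω i)) +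
        residRemainder fhat ghat (P n) n ω / σ n =
        ((√n)⁻¹ * ∑ i, residProd fhat ghat ω i) / σ n := by
      rw [residRemainder, Finset.sum_sub_distrib]
      ring
    have e2 : √(n : ℝ) * ((1 / n : ℝ) * ∑ i, residProd fhat ghat ω i) =
        (√n)⁻¹ * ∑ i, residProd fhat ghat ω i := by
      rw [← mul_assoc]
      congr 1
      rw [mul_one_div, Real.sqrt_div_self]
    rw [e1, div_div_div_cancel_right₀ (hσpos n).ne', gcmStat, e2]
    rfl
  have hpt : ∀ t, Tendsto (fun n => (sampleLaw (P n) n).real {ω | gcmStat fhat ghat ω ≤ t}) atTop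
      (𝓝 (cdf (gaussianReal 0 1) t)) := fun t =>
    tendsto_real_le_of_slutsky (μ := fun n => sampleLaw (P n) n)
      (T := fun n ω => gcmStat fhat ghat ω) continuous_cdf_gaussianReal hT hr hq hclt t
  exact tendsto_iSup_abs_sub_cdf continuous_cdf_gaussianReal
    (fun n s t hst => measureReal_mono (fun ω hω => le_trans hω hst))
    (fun n t => ⟨measureReal_nonneg, measureReal_le_one⟩) hpt

end SeqConditions

/-! ### From sequences of laws to uniformity over a class -/

/-- A supremum over a class tends to zero as soon as it does along every sequence in the class. -/
lemma tendsto_iSup_of_forall_seq {α : Type*} {S : Set α} {F : α → ℕ → ℝ≥0∞}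
    (h : ∀ P : ℕ → α, (∀ n, P n ∈ S) → Tendsto (fun n => F (P n) n) atTop (𝓝 0)) :
    Tendsto (fun n => ⨆ P ∈ S, F P n) atTop (𝓝 0) := by
  rcases S.eq_empty_or_nonempty with rfl | ⟨P₀, hP₀⟩
  · simp
  rw [ENNReal.tendsto_nhds_zero]
  intro ε hε
  -- For each n a law violating the bound ε is chosen whenever one exists; convergence along this
  -- sequence rules out violations for large n.
  have hex : ∀ n, ∃ Q ∈ S, (∃ P ∈ S, ε < F P n) → ε < F Q n := by
    intro n
    by_cases hn : ∃ P ∈ S, ε < F P n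
    · obtain ⟨P, hP, hlt⟩ := hn
      exact ⟨P, hP, fun _ => hlt⟩
    · exact ⟨P₀, hP₀, fun h => absurd h hn⟩
  choose Q hQ hQε using hex
  filter_upwards [(ENNReal.tendsto_nhds_zero.1 (h Q hQ)) ε hε] with n hn
  refine iSup₂_le fun P hP => ?_
  by_contra hlt
  exact absurd hn (not_le.2 (hQε n ⟨P, hP, not_le.1 hlt⟩))

lemma IsLittleOP.tendsto_seq {F : Type} [ENorm F] {Ps : Set (ProbabilityMeasure (Obs d))}
    {V : ProbabilityMeasure (Obs d) → (n : ℕ) → (Fin n → Obs d) → F} (hV : IsLittleOP Ps V)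
    {P : ℕ → ProbabilityMeasure (Obs d)} (hP : ∀ n, P n ∈ Ps) {ε : ℝ} (hε : 0 < ε) :
    Tendsto (fun n => sampleLaw (P n) n {ω | ENNReal.ofReal ε < ‖V (P n) n ω‖ₑ}) atTop (𝓝 0) :=
  tendsto_of_tendsto_of_tendsto_of_le_of_le tendsto_const_nhds (hV ε hε) (fun _ => zero_le)
    fun n => le_iSup₂ (f := fun P _ => sampleLaw P n {ω | ENNReal.ofReal ε < ‖V P n ω‖ₑ})
      (P n) (hP n)

/-- Asymptotic normality uniformly over a class with uniformly integrable squared noise products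
whose variances are bounded away from zero. -/
theorem tendsto_iSup_normalDist {fhat ghat : Regression d} (hf : fhat.IsMeasurable)
    (hg : ghat.IsMeasurable) {Ps : Set (ProbabilityMeasure (Obs d))} (hnull : Ps ⊆ nullClass d)
    (hmean : ∀ P ∈ Ps, HasCondMean coordX P ∧ HasCondMean coordY P)
    (hpred : PredictionConditions fhat ghat Ps) {c : ℝ} (hc : 0 < c)
    (h2 : ∀ P ∈ Ps, Integrable (fun o => noiseProd P o ^ 2) (P : Measure (Obs d)))
    (hvar : ∀ P ∈ Ps, c ≤ ∫ o, noiseProd P o ^ 2 ∂(P : Measure (Obs d)))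
    (hUI : ∀ δ > 0, ∃ M : ℝ, 0 ≤ M ∧ ∀ P ∈ Ps,
      ∫ o in {o | M < |noiseProd P o|}, noiseProd P o ^ 2 ∂(P : Measure (Obs d)) ≤ δ) :
    Tendsto (fun n => ⨆ P ∈ Ps, normalDist fhat ghat P n) atTop (𝓝 0) := by
  refine tendsto_iSup_of_forall_seq fun P hP => ?_
  have hcc := fun n => condCentered_of_mem_nullClass (hnull (hP n)) (hmean _ (hP n)).1
    (hmean _ (hP n)).2
  refine SeqConditions.tendsto_normalDist (P := P) ?_ hc fun n => hvar _ (hP n)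
  exact
    { fhat_measurable := hf
      ghat_measurable := hg
      condCentered_X := fun n => (hcc n).1
      condCentered_Y := fun n => (hcc n).2
      predErr := fun ε hε => by
        have := hpred.1.tendsto_seq hP hε
        simpa only [Real.enorm_eq_ofReal_abs, ENNReal.ofReal_lt_ofReal_iff_of_nonneg hε.le] using this
      weighted_X := fun ε hε => by simpa only [enorm_eq_self] using hpred.2.1.tendsto_seq hP hε
      weighted_Y := fun ε hε => by simpa only [enorm_eq_self] using hpred.2.2.tendsto_seq hP hε
      integrable_sq := fun n => h2 _ (hP n)
      uniformIntegrable := fun δ hδ => by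
        obtain ⟨M, hM0, hM⟩ := hUI δ hδ
        exact ⟨M, hM0, fun n => hM _ (hP n)⟩ }

/-! ### Moment conditions and uniform integrability -/

lemma noiseMoment_two (P : ProbabilityMeasure (Obs d)) :
    noiseMoment P 2 = ∫⁻ o, ENNReal.ofReal (noiseProd P o ^ 2) ∂(P : Measure (Obs d)) := by
  simp [noiseMoment, noiseProd, -abs_mul]

lemma integrable_sq_of_noiseMoment_lt_top {P : ProbabilityMeasure (Obs d)}
    (h : noiseMoment P 2 < ∞) :
    Integrable (fun o => noiseProd P o ^ 2) (P : Measure (Obs d)) := by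
  refine ⟨((measurable_noiseProd P).pow_const 2).aestronglyMeasurable, ?_⟩
  rw [hasFiniteIntegral_iff_ofReal (ae_of_all _ fun _ => sq_nonneg _), ← noiseMoment_two]
  exact h

lemma ofReal_integral_sq_eq_noiseMoment {P : ProbabilityMeasure (Obs d)}
    (h : Integrable (fun o => noiseProd P o ^ 2) (P : Measure (Obs d))) :
    ENNReal.ofReal (∫ o, noiseProd P o ^ 2 ∂(P : Measure (Obs d))) = noiseMoment P 2 := by
  rw [noiseMoment_two, ofReal_integral_eq_lintegral_ofReal h (ae_of_all _ fun _ => sq_nonneg _)]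

/-- A single square integrable variable is uniformly integrable. -/
lemma exists_setIntegral_sq_le {E : Type*} [MeasurableSpace E] {μ : Measure E} {W : E → ℝ}
    (hW : Measurable W) (h2 : Integrable (fun o => W o ^ 2) μ) {δ : ℝ} (hδ : 0 < δ) :
    ∃ M : ℝ, 0 ≤ M ∧ ∫ o in {o | M < |W o|}, W o ^ 2 ∂μ ≤ δ := by
  have hm : ∀ k : ℕ, MeasurableSet {o | (k : ℝ) < |W o|} := fun k =>
    measurableSet_lt measurable_const (by fun_prop)
  have hanti : Antitone fun k : ℕ => {o | (k : ℝ) < |W o|} := fun k l hkl o ho =>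
    lt_of_le_of_lt (Nat.cast_le.2 hkl) (show (l : ℝ) < |W o| from ho)
  have hlim := tendsto_setIntegral_of_antitone hm hanti ⟨0, h2.integrableOn⟩
  have hempty : ⋂ k : ℕ, {o | (k : ℝ) < |W o|} = ∅ := by
    ext o
    obtain ⟨k, hk⟩ := exists_nat_ge |W o|
    simp only [Set.mem_iInter, Set.mem_ofPred_eq, Set.mem_empty_iff_false, iff_false, not_forall,
      not_lt]
    exact ⟨k, hk⟩
  rw [hempty, setIntegral_empty] at hlim
  obtain ⟨k, hk⟩ := (hlim.eventually (gt_mem_nhds hδ)).exists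
  exact ⟨k, k.cast_nonneg, hk.le⟩

/-- Moments of order larger than two control the tails of squares. -/
lemma setIntegral_sq_le_of_moment {E : Type*} [MeasurableSpace E] {μ : Measure E} {W : E → ℝ}
    (hW : Measurable W) {η c : ℝ} (hη : 0 < η) (hc : 0 ≤ c)
    (hmom : ∫⁻ o, ENNReal.ofReal (|W o| ^ (2 + η)) ∂μ ≤ ENNReal.ofReal c)
    {M : ℝ} (hM : 0 < M) :
    ∫ o in {o | M < |W o|}, W o ^ 2 ∂μ ≤ c / M ^ η := by
  have hA : MeasurableSet {o | M < |W o|} := measurableSet_lt measurable_const (by fun_prop)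
  have hMη : 0 < M ^ η := Real.rpow_pos_of_pos hM η
  -- Where |W| > M, the factor |W|^η / M^η exceeds 1.
  have hpt : ∀ o, {o | M < |W o|}.indicator (fun o => W o ^ 2) o ≤ |W o| ^ (2 + η) / M ^ η := by
    intro o
    by_cases ho : o ∈ {o | M < |W o|}
    · have ho' : M < |W o| := ho
      have h0 : 0 < |W o| := hM.trans ho'
      rw [Set.indicator_of_mem ho, le_div_iff₀ hMη, Real.rpow_add h0, ← sq_abs]
      have := Real.rpow_le_rpow hM.le ho'.le hη.le
      rw [← Real.rpow_natCast]
      exact mul_le_mul_of_nonneg_left this (by positivity)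
    · rw [Set.indicator_of_notMem ho]
      positivity
  rw [← integral_indicator hA, integral_eq_lintegral_of_nonneg_ae
    (ae_of_all _ fun _ => Set.indicator_nonneg (fun _ _ => sq_nonneg _) _)
    ((hW.pow_const 2).indicator hA).aestronglyMeasurable]
  refine ENNReal.toReal_le_of_le_ofReal (by positivity) ?_
  refine (lintegral_mono fun o => ENNReal.ofReal_le_ofReal (hpt o)).trans ?_
  simp_rw [ENNReal.ofReal_div_of_pos hMη]
  simp_rw [div_eq_mul_inv]
  rw [lintegral_mul_const _ (by fun_prop)]
  exact mul_le_mul_left hmom _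

end GCM

/-! ### The pointwise and the uniform statement -/

theorem theorem2 (d : ℕ) (fhat ghat : GCM.Regression d)
    (hf : fhat.IsMeasurable) (hg : ghat.IsMeasurable) :
    (∀ P ∈ GCM.nullClass d,
      GCM.HasCondMean GCM.coordX P → GCM.HasCondMean GCM.coordY P →
      GCM.PredictionConditions fhat ghat {P} →
      0 < GCM.noiseMoment P 2 → GCM.noiseMoment P 2 < ∞ →
      Tendsto (fun n : ℕ => GCM.normalDist fhat ghat P n) atTop (𝓝 0)) ∧
    (∀ Ps : Set (ProbabilityMeasure (GCM.Obs d)), Ps ⊆ GCM.nullClass d →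
      (∀ P ∈ Ps, GCM.HasCondMean GCM.coordX P ∧ GCM.HasCondMean GCM.coordY P) →
      GCM.PredictionConditions fhat ghat Ps →
      ∀ c₁ c₂ η : ℝ, 0 < c₁ → 0 < c₂ → 0 < η →
      (∀ P ∈ Ps, ENNReal.ofReal c₁ ≤ GCM.noiseMoment P 2) →
      (∀ P ∈ Ps, GCM.noiseMoment P (2 + η) ≤ ENNReal.ofReal c₂) →
      Tendsto (fun n : ℕ => ⨆ P ∈ Ps, GCM.normalDist fhat ghat P n) atTop (𝓝 0)) := by
  constructor
  · intro P hP hX hY hpred hpos hfin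
    have h2 := GCM.integrable_sq_of_noiseMoment_lt_top hfin
    rw [← GCM.ofReal_integral_sq_eq_noiseMoment h2, ENNReal.ofReal_pos] at hpos
    -- For a single law the variance itself serves as lower bound, and integrability alone gives the
    -- tail condition.
    have h := GCM.tendsto_iSup_normalDist hf hg (Ps := {P}) (Set.singleton_subset_iff.2 hP)
      (by rintro _ rfl; exact ⟨hX, hY⟩) hpred hpos (by rintro _ rfl; exact h2)
      (by rintro _ rfl; exact le_rfl) (fun δ hδ => by
        obtain ⟨M, hM0, hM⟩ := GCM.exists_setIntegral_sq_le (GCM.measurable_noiseProd P) h2 hδ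
        exact ⟨M, hM0, by rintro _ rfl; exact hM⟩)
    simpa using h
  · intro Ps hnull hmean hpred c₁ c₂ η hc₁ hc₂ hη hlow hup
    have hfin : ∀ P ∈ Ps, GCM.noiseMoment P 2 < ∞ := by
      intro P hP
      rw [GCM.noiseMoment_two]
      -- Finiteness of the second moment follows from w² ≤ 1 + |w|^(2+η).
      have hpt : ∀ o, ENNReal.ofReal (GCM.noiseProd P o ^ 2) ≤
          1 + ENNReal.ofReal (|GCM.noiseProd P o| ^ (2 + η)) := by
        intro o
        rcases le_total |GCM.noiseProd P o| 1 with h | h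
        · refine le_add_right (ENNReal.ofReal_le_one.2 ?_)
          rw [← sq_abs]
          exact pow_le_one₀ (abs_nonneg _) h
        · refine le_add_left (ENNReal.ofReal_le_ofReal ?_)
          rw [← sq_abs, ← Real.rpow_natCast]
          exact Real.rpow_le_rpow_of_exponent_le h (by push_cast; linarith)
      refine (lintegral_mono hpt).trans_lt ?_
      rw [lintegral_add_left measurable_const]
      have := (hup P hP).trans_lt ENNReal.ofReal_lt_top
      rw [GCM.noiseMoment] at this
      simpa [GCM.noiseProd] using this
    have h2 := fun P hP => GCM.integrable_sq_of_noiseMoment_lt_top (hfin P hP)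
    refine GCM.tendsto_iSup_normalDist hf hg hnull hmean hpred hc₁ h2 (fun P hP => ?_)
      fun δ hδ => ?_
    · have := hlow P hP
      rw [← GCM.ofReal_integral_sq_eq_noiseMoment (h2 P hP)] at this
      exact (ENNReal.ofReal_le_ofReal_iff (integral_nonneg fun _ => sq_nonneg _)).1 this
    -- This level solves c₂ / M^η = δ and does not depend on P.
    · have hM : 0 < (c₂ / δ) ^ η⁻¹ := by positivity
      refine ⟨(c₂ / δ) ^ η⁻¹, hM.le, fun P hP => ?_⟩
      refine (GCM.setIntegral_sq_le_of_moment (GCM.measurable_noiseProd P) hη hc₂.le (hup P hP)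
        hM).trans (le_of_eq ?_)
      rw [Real.rpow_inv_rpow (by positivity) hη.ne']
      field_simp
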